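/- Let $m\ge 1$, $n\ge 2$, let $A\in\mathbb Z^{m\times n}$ have full row rank and let $b\in\mathbb Z^m$. Let $L$ be the encoding size of $(A,b)$, i.e. the sum of $1+\lceil\log_2(|a|+1)\rceil$ over all entries $a$ of $(A,b)$, and let $\Delta$ be the product of the Euclidean norms of the $m$ columns of $(A,b)$ of largest norm. Consider the following algorithm for the problem $Ax=b$, $x\ge 0$. *Bubble algorithm.* Input: a system $Ax=b$, $x\ge0$ in $t$ variables and $u\in\mathbb R^t$, $u>0$. Put $\ell=u/(2t)$, $D=\mathrm{diag}(4u_j^{-2})$, $\|x\|_D^2=x^\top Dx$. Compute by orthogonal elimination the point $r$ of $\{x: Ax=b\}$ of minimum $D$-norm (if $Ax=b$ has no solution, return $(v,0)$ with $A^\top v=0$, $b^\top v>0$). If $\|r\|_D>2\sqrt t$, return $(v,0)$ with $Dr=A^\top v$, $\|r\|_D^2=b^\top v$; otherwise, if $r\ge0$, return $r$; otherwise, if some $x_j$ is constant on $\{x:Ax=b\}$ with value less than $\ell_j$, return $(v,w)$ with $w=e^j$, $A^\top v+w=0$, $b^\top v+\ell^\top w>0$; otherwise let $z$ be the point of minimum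 $D$-norm in $\{x: Ax=b,\ x_j=\ell_j\}$, where $j$ with $r_j<\ell_j$ is chosen so that the $D$-distance of $r$ from this set is largest. While $\|z\|_D\le 2\sqrt t$: if $z\ge 0$, return $z$; otherwise let $i$ be the first index with $z_i<0$ and let $K=\{x: Ax=b,\ z^\top Dx\ge\|z\|_D^2,\ x_i\ge\ell_i\}$; if $K=\emptyset$, return $(v,w)$ with $w\ge0$, $A^\top v+w=0$, $b^\top v+\ell^\top w>0$; otherwise replace $z$ by the point of $K$ of minimum $D$-norm. After the loop return $(v,w)$ with $w\ge 0$, $Dz=A^\top v+w$, $\|z\|_D^2=b^\top v+\ell^\top w$. *LP algorithm.* Start with all variables free and $u_j=\Delta$ for all $j$. In each iteration consider the system restricted to the $t$ free variables, the others being fixed to $0$. If its equations have no solution, answer "infeasible"; if they have exactly one solution, answer with it (extended by zeros) if it is nonnegative and "infeasible" otherwise. Otherwise call the Bubble algorithm for the restricted system and $u$. If it returns a feasible point, answer with this point extended by zeros. If it returns $(v,w)$ with $w=0$, answer "infeasible". If it returns $(v,w)$ with $w\neq0$, put $u_j'=\min\{u_j,\ (\sum_i u_iw_i)/(2t\,w_j)\}$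 (and $u'_j=u_j$ if $w_j=0$) for each free $j$, fix to $0$ all variables with $u'_j<\Delta^{-1}$, and replace $u_j$ by $u_j'$ for the others. In the version *with rounding*, $u_j$ is replaced instead by the smallest integer multiple of $1/(3n\Delta)$ that is at least $u_j'$. In both versions the algorithm halts, and it is correct: its answer is either a vector $x\geq 0$ with $Ax=b$, or "infeasible", and then no such $x$ exists. There is an absolute constant $C$ such that in both versions, for all $m,n,A,b$ as above, it makes at most $C\,\frac{n}{\log n}L$ calls to the Bubble algorithm and performs at most $C\,\frac{n^5}{\log n}L$ arithmetic operations in total. (The arithmetic is exact; each of $+,-,\times,\div$, comparison, square root, rounding up to an integer, and loading a natural number counts as one operation. All operations are counted, including those of the Bubble calls, of the elimination and of the computation of $\Delta$.) -/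

import Mathlib

/-!
The algorithms are written over an abstract type `R` of numbers, on which they can act only
through a `Machine`: every arithmetic operation, comparison, square root, rounding and loading of
a natural number is an instruction whose cost is recorded.  Handling of indices and of lists, and
moving numbers around, is not arithmetic and is free.
-/

namespace BubbleLP

/-- The result of a computation, the number of arithmetic operations that it performed, and the
number of calls to the Bubble algorithm that it made. -/
structure Cost (α : Type) where
  val : α
  ops : ℕ
  calls : ℕ

instance : Monad Cost where
  pure a := ⟨a, 0, 0⟩
  bind x f := ⟨(f x.val).val, x.ops + (f x.val).ops, x.calls + (f x.val).calls⟩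

/-- One elementary operation. -/
def Cost.op {α : Type} (a : α) : Cost α := ⟨a, 1, 0⟩

/-- Record one call of a subroutine. -/
def Cost.call {α : Type} (x : Cost α) : Cost α := ⟨x.val, x.ops, x.calls + 1⟩

/-- Compute all the entries of a vector. -/
def Cost.vec {α : Type} {n : ℕ} (f : Fin n → Cost α) : Cost (Fin n → α) :=
  ⟨fun i => (f i).val, ∑ i, (f i).ops, ∑ i, (f i).calls⟩

/-- Repeat `step` until it returns a result, but at most `k` times.  The value is the result if
there is one, and the current state otherwise. -/
def Cost.iterate {σ α : Type} (step : σ → Cost (σ ⊕ α)) : ℕ → σ → Cost (σ ⊕ α)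
  | 0, s => pure (Sum.inl s)
  | k + 1, s => do
    match ← step s with
    | Sum.inr a => pure (Sum.inr a)
    | Sum.inl s₁ => Cost.iterate step k s₁

/-- The first element of a list that passes a test. -/
def Cost.find {α : Type} (p : α → Cost Bool) : List α → Cost (Option α)
  | [] => pure none
  | a :: l => do
    if ← p a then pure (some a) else Cost.find p l

/-- The elements of a list that pass a test. -/
def Cost.filter {α : Type} (p : α → Cost Bool) : List α → Cost (List α)
  | [] => pure []
  | a :: l => do
    let t ← p a
    let k ← Cost.filter p l
    pure (if t then a :: k else k)

/-- The instructions on numbers. -/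
structure Machine (R : Type) where
  const : ℕ → Cost R
  add : R → R → Cost R
  sub : R → R → Cost R
  mul : R → R → Cost R
  div : R → R → Cost R
  lt : R → R → Cost Bool
  sqrt : R → Cost R
  ceil : R → Cost R

open Classical in
/-- Exact real arithmetic, with unit cost for each instruction. -/
noncomputable def realMachine : Machine ℝ where
  const k := Cost.op (k : ℝ)
  add x y := Cost.op (x + y)
  sub x y := Cost.op (x - y)
  mul x y := Cost.op (x * y)
  div x y := Cost.op (x / y)
  lt x y := Cost.op (decide (x < y))
  sqrt x := Cost.op (Real.sqrt x)
  ceil x := Cost.op (⌈x⌉ : ℝ)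

section

variable {R : Type} (M : Machine R) {m n : ℕ}

/-! ### Vectors -/

/-- `∑ i, x i`. -/
def sum : {n : ℕ} → (Fin n → R) → Cost R
  | 0, _ => M.const 0
  | k + 1, x => do
    let s ← sum fun i : Fin k => x i.castSucc
    M.add s (x (Fin.last k))

/-- `∑ i, x i * y i`. -/
def dot (x y : Fin n → R) : Cost R := do
  let p ← Cost.vec fun i => M.mul (x i) (y i)
  sum M p

/-- `∑ i, e i * x i * y i`. -/
def wdot (e x y : Fin n → R) : Cost R := do
  let p ← Cost.vec fun i => M.mul (e i) (x i)
  dot M p y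

/-- `x + c • y`. -/
def addMul (x : Fin n → R) (c : R) (y : Fin n → R) : Cost (Fin n → R) :=
  Cost.vec fun i => do
    let p ← M.mul c (y i)
    M.add (x i) p

/-- `x - c • y`. -/
def subMul (x : Fin n → R) (c : R) (y : Fin n → R) : Cost (Fin n → R) :=
  Cost.vec fun i => do
    let p ← M.mul c (y i)
    M.sub (x i) p

/-- `c • x`. -/
def smul (c : R) (x : Fin n → R) : Cost (Fin n → R) :=
  Cost.vec fun i => M.mul c (x i)

/-- The zero vector. -/
def zeroVec (n : ℕ) : Cost (Fin n → R) :=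
  Cost.vec fun _ => M.const 0

/-- The `j`-th unit vector. -/
def unitVec (j : Fin n) : Cost (Fin n → R) :=
  Cost.vec fun i => M.const (if i = j then 1 else 0)

/-- A negative coordinate of `x`, if there is one. -/
def findNeg (x : Fin n → R) : Cost (Option (Fin n)) :=
  Cost.find (fun i => do let o ← M.const 0; M.lt (x i) o) (List.finRange n)

/-! ### Linear equations

For `u > 0` let `D` be the diagonal matrix with entries `4 / u i ^ 2`.  The system `A x = b` is
brought by elimination to an equivalent one whose rows are orthogonal for `D⁻¹`. -/

/-- The diagonal of `D⁻¹`. -/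
def invD (u : Fin n → R) : Cost (Fin n → R) :=
  Cost.vec fun i => do
    let p ← M.mul (u i) (u i)
    let q ← M.const 4
    M.div p q

/-- An equation `row ⬝ x = rhs`, where `row = Aᵀ mult`, `rhs = b ⬝ mult`, and `nrm` stands for
`row ⬝ D⁻¹ row`. -/
structure Equation (R : Type) (m n : ℕ) where
  row : Fin n → R
  rhs : R
  mult : Fin m → R
  nrm : R

/-- Make an equation orthogonal to the given ones (with `e` the diagonal of `D⁻¹`). -/
def reduce (e : Fin n → R) :
    List (Equation R m n) → Equation R m n → Cost (Equation R m n)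
  | [], q => do
    let s ← wdot M e q.row q.row
    pure { q with nrm := s }
  | p :: l, q => do
    let a ← wdot M e p.row q.row
    let c ← M.div a p.nrm
    let row ← subMul M q.row c p.row
    let d ← M.mul c p.rhs
    let rhs ← M.sub q.rhs d
    let mult ← subMul M q.mult c p.mult
    reduce e l ⟨row, rhs, mult, q.nrm⟩

/-- Elimination.  Returns either an orthogonal system equivalent to `A x = b` and without
redundant equations, or `v` with `Aᵀ v = 0` and `b ⬝ v > 0`. -/
def eliminate (e : Fin n → R) (A : Fin m → Fin n → R) (b : Fin m → R) :
    List (Fin m) → List (Equation R m n) → Cost (List (Equation R m n) ⊕ (Fin m → R))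
  | [], B => pure (Sum.inl B)
  | i :: l, B => do
    let o ← M.const 0
    let y ← unitVec M i
    let q ← reduce M e B ⟨A i, b i, y, o⟩
    if ← M.lt o q.nrm then
      eliminate e A b l (q :: B)
    else if ← M.lt o q.rhs then
      pure (Sum.inr q.mult)
    else if ← M.lt q.rhs o then do
      let z ← zeroVec M m
      let k ← M.const 1
      let v ← subMul M z k q.mult
      pure (Sum.inr v)
    else
      eliminate e A b l B

/-- The linear combination of the multipliers `p.mult` with the coefficients `coef p`. -/
def combine (coef : Equation R m n → Cost R) : List (Equation R m n) → Cost (Fin m → R)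
  | [] => zeroVec M m
  | p :: l => do
    let x ← combine coef l
    let c ← coef p
    addMul M x c p.mult

/-- `v` such that `D⁻¹ Aᵀ v` is the point of `A x = b` of minimum `D`-norm. -/
def closestMult (B : List (Equation R m n)) : Cost (Fin m → R) :=
  combine M (fun p => M.div p.rhs p.nrm) B

/-- `D⁻¹ Aᵀ v`. -/
def scaledMul (e : Fin n → R) (A : Fin m → Fin n → R) (v : Fin m → R) : Cost (Fin n → R) :=
  Cost.vec fun j => do
    let s ← dot M (fun i => A i j) v
    M.mul (e j) s

/-- `v` such that `D⁻¹ (Aᵀ v + e^j)` is the `D`-orthogonal projection of `D⁻¹ e^j` on the kernel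
of `A`. -/
def normalMult (e : Fin n → R) (B : List (Equation R m n)) (j : Fin n) : Cost (Fin m → R) :=
  combine M (fun p => do
    let o ← M.const 0
    let a ← M.mul (e j) (p.row j)
    let c ← M.div a p.nrm
    M.sub o c) B

/-- `D⁻¹ (Aᵀ v + e^j)`. -/
def normalVec (e : Fin n → R) (A : Fin m → Fin n → R) (j : Fin n) (v : Fin m → R) :
    Cost (Fin n → R) := do
  let f ← unitVec M j
  Cost.vec fun k => do
    let s ← dot M (fun i => A i k) v
    let a ← M.add s (f k)
    M.mul (e k) a

/-! ### The Bubble algorithm -/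

/-- What is computed once at the start of the Bubble algorithm: the point `r` of `A x = b` of
minimum `D`-norm, `r = D⁻¹ Aᵀ v₀`, the square `ρ` of its `D`-norm, and for each `j` the vector
`g j = D⁻¹ (Aᵀ (v j) + e^j)` in the kernel of `A` and `c j = ℓ j - r j`.  On the solutions of
`A x = b`, the inequality `x j ≥ ℓ j` reads `⟨g j, x - r⟩_D ≥ c j`, and `g j j` is the square of
the `D`-norm of `g j`. -/
structure Setup (R : Type) (m n : ℕ) where
  r : Fin n → R
  v₀ : Fin m → R
  ρ : R
  g : Fin n → Fin n → R
  v : Fin n → Fin m → R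
  c : Fin n → R

def setup (A : Fin m → Fin n → R) (b : Fin m → R) (u e : Fin n → R)
    (B : List (Equation R m n)) : Cost (Setup R m n) := do
  let v₀ ← closestMult M B
  let r ← scaledMul M e A v₀
  let ρ ← dot M b v₀
  let v ← Cost.vec fun j => normalMult M e B j
  let g ← Cost.vec fun j => normalVec M e A j (v j)
  let c ← Cost.vec fun j => do
    let k ← M.const (2 * n)
    let l ← M.div (u j) k
    M.sub l (r j)
  pure ⟨r, v₀, ρ, g, v, c⟩

/-- The current point `z = r + y` of the Bubble algorithm, where `y = ∑ j, lam j • g j` with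
`lam ≥ 0`, and `θ = ∑ j, lam j * c j` is the square of the `D`-norm of `y`. -/
structure BubbleState (R : Type) (n : ℕ) where
  lam : Fin n → R
  y : Fin n → R
  θ : R

/-- A feasible point, or a pair `(v, w)`. -/
inductive BubbleOut (R : Type) (m n : ℕ) where
  | point (x : Fin n → R)
  | cert (v : Fin m → R) (w : Fin n → R)

/-- `x + ∑ j, lam j • V j`. -/
def addComb (x : Fin m → R) (lam : Fin n → R) (V : Fin n → Fin m → R) : Cost (Fin m → R) :=
  Cost.vec fun i => do
    let s ← dot M lam fun j => V j i
    M.add (x i) s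

/-- The pair `(v, w)` with `D z = Aᵀ v + w` and `‖z‖_D ^ 2 = b ⬝ v + ℓ ⬝ w`. -/
def stateCert (S : Setup R m n) (s : BubbleState R n) : Cost (BubbleOut R m n) := do
  let v ← addComb M S.v₀ s.lam S.v
  pure (BubbleOut.cert v s.lam)

/-- The body of the while loop.  If the norm is beyond the bound, output the certificate of `z`.
If `z ≥ 0`, output `z`.  Otherwise take `i` with `z i < 0`; then
`K = {x | A x = b, ⟨y, x - r⟩_D ≥ θ, ⟨g i, x - r⟩_D ≥ c i}`, and `K` is empty if and only if
`g i` and `y` are linearly dependent.  If `K` is empty, output `(v, w)` with `Aᵀ v + w = 0` and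
`b ⬝ v + ℓ ⬝ w > 0`, else move to the point of `K` of minimum `D`-norm, at which both
inequalities are tight. -/
def bubbleStep (S : Setup R m n) (s : BubbleState R n) :
    Cost (BubbleState R n ⊕ BubbleOut R m n) := do
  let norm ← M.add S.ρ s.θ
  let bound ← M.const (4 * n)
  if ← M.lt bound norm then
    let out ← stateCert M S s
    pure (Sum.inr out)
  else
    let z ← Cost.vec fun j => M.add (S.r j) (s.y j)
    match ← findNeg M z with
    | none => pure (Sum.inr (BubbleOut.point z))
    | some i =>
      let o ← M.const 0
      let h := s.y i
      let a ← M.mul (S.g i i) s.θ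
      let hh ← M.mul h h
      let det ← M.sub a hh
      let f ← unitVec M i
      if ← M.lt o det then
        let d ← M.sub (S.c i) h
        let p ← M.mul s.θ d
        let μ₁ ← M.div p det
        let q ← M.mul h (S.c i)
        let k ← M.sub a q
        let μ₂ ← M.div k det
        let l₁ ← smul M μ₂ s.lam
        let lam ← addMul M l₁ μ₁ f
        let y₁ ← smul M μ₂ s.y
        let y ← addMul M y₁ μ₁ (S.g i)
        let t₁ ← M.mul μ₁ (S.c i)
        let t₂ ← M.mul μ₂ s.θ
        let θ ← M.add t₁ t₂
        pure (Sum.inl ⟨lam, y, θ⟩)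
      else
        let ν ← M.div h s.θ
        let lam ← subMul M f ν s.lam
        let x ← zeroVec M m
        let v ← addComb M x lam S.v
        pure (Sum.inr (BubbleOut.cert v lam))

/-- `c j ^ 2 / ‖g j‖_D ^ 2`: the square of the `D`-distance of `r` from `x j = ℓ j`. -/
def sqDist (S : Setup R m n) (j : Fin n) : Cost R := do
  let p ← M.mul (S.c j) (S.c j)
  M.div p (S.g j j)

/-- Among the violated inequalities `x j ≥ ℓ j`, the one at largest `D`-distance from `r`. -/
def farthest (S : Setup R m n) : List (Fin n) → Fin n × R → Cost (Fin n × R)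
  | [], best => pure best
  | j :: l, best => do
    let o ← M.const 0
    if ← M.lt o (S.c j) then
      let d ← sqDist M S j
      if ← M.lt best.2 d then farthest S l (j, d) else farthest S l best
    else farthest S l best

/-- The Bubble algorithm for `A x = b`, `x ≥ 0` with the bounds `u`, `ℓ = u / (2 n)`.

It starts at the point `r` of `A x = b` of minimum `D`-norm.  If `A x = b` has no solution, or if
`‖r‖_D > 2 √n`, the output is `(v, 0)`.  If some `x j` is constant on the solutions of `A x = b`
and less than `ℓ j`, the output is a certificate with `w = e^j`.  The first move is
to the farthest hyperplane `x j = ℓ j` that bounds a violated inequality.  The while loop makes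
at most `4 n ^ 3` moves. -/
def bubble (A : Fin m → Fin n → R) (b : Fin m → R) (u : Fin n → R) :
    Cost (BubbleOut R m n) := do
  let e ← invD M u
  match ← eliminate M e A b (List.finRange m) [] with
  | Sum.inr v =>
    let w ← zeroVec M n
    pure (BubbleOut.cert v w)
  | Sum.inl B =>
    let S ← setup M A b u e B
    let bound ← M.const (4 * n)
    if ← M.lt bound S.ρ then
      let w ← zeroVec M n
      pure (BubbleOut.cert S.v₀ w)
    else
      match ← findNeg M S.r with
      | none => pure (BubbleOut.point S.r)
      | some i =>
        let o ← M.const 0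
        let empty ← Cost.find (fun j => do
          let t₁ ← M.lt o (S.c j)
          let t₂ ← M.lt o (S.g j j)
          pure (t₁ && !t₂)) (List.finRange n)
        match empty with
        | some j =>
          let w ← unitVec M j
          pure (BubbleOut.cert (S.v j) w)
        | none =>
          let d ← sqDist M S i
          let best ← farthest M S (List.finRange n) (i, d)
          let j := best.1
          let a ← M.div (S.c j) (S.g j j)
          let f ← unitVec M j
          let lam ← smul M a f
          let y ← smul M a (S.g j)
          match ← Cost.iterate (bubbleStep M S) (4 * n ^ 3 + 1) ⟨lam, y, best.2⟩ with
          | Sum.inr out => pure out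
          | Sum.inl s => stateCert M S s

/-! ### The full algorithm -/

/-- Insertion into a list that is sorted in decreasing order. -/
def insertDesc (x : R) : List R → Cost (List R)
  | [] => pure [x]
  | y :: l => do
    if ← M.lt y x then pure (x :: y :: l)
    else
      let k ← insertDesc x l
      pure (y :: k)

/-- Sorting in decreasing order. -/
def sortDesc : List R → Cost (List R)
  | [] => pure []
  | x :: l => do
    let k ← sortDesc l
    insertDesc M x k

/-- The product of a list. -/
def prod : List R → Cost R
  | [] => M.const 1
  | x :: l => do
    let k ← prod l
    M.mul x k

/-- `Δ`, the product of the Euclidean norms of the `m` columns of `(A, b)` of largest norm. -/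
def delta (A : Fin m → Fin n → R) (b : Fin m → R) : Cost R := do
  let cols ← Cost.vec fun j : Fin n => dot M (fun i => A i j) fun i => A i j
  let last ← dot M b b
  let l ← sortDesc M (last :: List.ofFn cols)
  let p ← prod M (l.take m)
  M.sqrt p

/-- The variables that are not yet fixed to `0`, listed by `idx`, and their upper bounds. -/
structure LPState (R : Type) (n : ℕ) where
  size : ℕ
  idx : Fin size → Fin n
  u : Fin size → R

/-- Put `0` for the variables that are fixed. -/
def extend {k : ℕ} (idx : Fin k → Fin n) (x : Fin k → R) : Cost (Fin n → R) :=
  Cost.vec fun i =>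
    match (List.finRange k).find? fun j => decide (idx j = i) with
    | some j => pure (x j)
    | none => M.const 0

/-- `min {u j, (∑ i, u i * w i) / (2 k w j)}`, where `tot = ∑ i, u i * w i`. -/
def newBound {k : ℕ} (tot : R) (u w : Fin k → R) (j : Fin k) : Cost R := do
  let o ← M.const 0
  if ← M.lt o (w j) then
    let a ← M.const (2 * k)
    let p ← M.mul a (w j)
    let q ← M.div tot p
    if ← M.lt q (u j) then pure q else pure (u j)
  else pure (u j)

/-- The smallest integer multiple of `1 / (3 n Δ)` that is at least `x`. -/
def roundUp (n : ℕ) (Δ x : R) : Cost R := do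
  let a ← M.const (3 * n)
  let p ← M.mul a Δ
  let q ← M.mul x p
  let k ← M.ceil q
  M.div k p

/-- One iteration of the algorithm, on the system `A x = b`, `x ≥ 0` restricted to the variables
that are not fixed.  If the restricted system of equations has no solution or a unique one,
the answer is clear.  Otherwise call the Bubble algorithm.  If it returns `(v, w)` with `w ≠ 0`,
shrink the bounds, fix the variables whose new bound is less than `1 / Δ`, and go on; with
`w = 0` there is no feasible solution.  The answer `none` stands for "infeasible". -/
def lpStep (rounding : Bool) (A : Fin m → Fin n → R) (b : Fin m → R) (Δ : R)
    (s : LPState R n) : Cost (LPState R n ⊕ Option (Fin n → R)) := do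
  let A₁ : Fin m → Fin s.size → R := fun i j => A i (s.idx j)
  let e ← invD M s.u
  match ← eliminate M e A₁ b (List.finRange m) [] with
  | Sum.inr _ => pure (Sum.inr none)
  | Sum.inl B =>
    if B.length = s.size then
      let v ← closestMult M B
      let x ← scaledMul M e A₁ v
      match ← findNeg M x with
      | some _ => pure (Sum.inr none)
      | none =>
        let x₁ ← extend M s.idx x
        pure (Sum.inr (some x₁))
    else
      match ← (bubble M A₁ b s.u).call with
      | BubbleOut.point x =>
        let x₁ ← extend M s.idx x
        pure (Sum.inr (some x₁))
      | BubbleOut.cert _ w =>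
        let o ← M.const 0
        let tot ← dot M s.u w
        if ← M.lt o tot then
          let u₁ ← Cost.vec (newBound M tot s.u w)
          let one ← M.const 1
          let inv ← M.div one Δ
          let keep ← Cost.filter (fun j => do
            let t ← M.lt (u₁ j) inv
            pure (!t)) (List.finRange s.size)
          let u₂ ← if rounding then Cost.vec fun j => roundUp M n Δ (u₁ j) else pure u₁
          pure (Sum.inl ⟨keep.length, fun j => s.idx (keep.get j), fun j => u₂ (keep.get j)⟩)
        else pure (Sum.inr none)

/-- The full algorithm, stopped after `k` iterations if it has not halted before.  All the bounds
are `Δ` at the start. -/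
def lpAlgorithm (rounding : Bool) (A : Fin m → Fin n → R) (b : Fin m → R) (k : ℕ) :
    Cost (LPState R n ⊕ Option (Fin n → R)) := do
  let Δ ← delta M A b
  Cost.iterate (lpStep M rounding A b Δ) k ⟨n, id, fun _ => Δ⟩

end

/-! ### Encoding size -/

/-- Binary encoding length of an integer: a sign and `⌈log₂ (|a| + 1)⌉` digits. -/
def intSize (a : ℤ) : ℕ := 1 + Nat.clog 2 (a.natAbs + 1)

/-- Encoding size of `(A, b)`. -/
def encodingSize {m n : ℕ} (A : Matrix (Fin m) (Fin n) ℤ) (b : Fin m → ℤ) : ℕ :=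
  (∑ i, ∑ j, intSize (A i j)) + ∑ i, intSize (b i)

end BubbleLP

namespace BubbleLP

/-! Three facts combine: there are O(nL / log n) iterations, each makes at most one Bubble call, and
each costs O(n⁴) operations.

Bubble call. The minimum-norm point r is D-orthogonal to the kernel of A, so every iterate is z = r
+ y with y in the kernel and ‖z‖² = ‖r‖² + ‖y‖². The Riesz representatives g j of the coordinates
turn x_j ≥ ℓ_j into a half-space of the kernel. A move to the nearest point of K gives y' with ⟨y,
y'⟩ = ‖y‖², hence ‖y'‖² = ‖y‖² + ‖y' - y‖². Coordinate i alone changes by more than ℓ_i = u_i/(2n),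
which adds at least 1/n² to the squared norm (`Invariant.next`, `bubbleStep_spec`). After at most
4n³ moves ‖z‖² exceeds 4n, the maximum of the squared norm on the box 0 ≤ x ≤ u, and then z
separates: w·x < w·ℓ for all feasible x in the box (`IsSetup.isCert_of_norm`). A move costs O(n),
and the quadratic work of writing out a certificate is done once.

Shrinking. With k free variables, w·x < w·ℓ gives x_j ≤ u'_j. The ratios u_j/u'_j are at least 1 and
at least 2k u_j w_j / (u·w), so the product of the bounds drops by a factor of at least k + 1
(`log_succ_le_sum_log_div`). Rounding loses at most 1/3 of the gain log(k+1), which leaves at least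
half of it (`LPInvariant.progress`). The potential, the sum of log(u_j Δ), lies between 0 and 2k log
Δ. While k > √n, an iteration that fixes no variable gains at least (log n)/4. Once k ≤ √n the
potential is at most 2√n log Δ and each gain exceeds 1/3. At most n iterations fix a variable.
Together with n ≤ L and log Δ ≤ L (`log_Delta_le`) this gives the count
(`Progress.budget_add_one_le`, `budget_init_add_one_le`).

Correctness. A feasible system has a solution with independent support. By Cramer's rule and
Hadamard's inequality its nonzero entries lie in [1/Δ, Δ] (`exists_bounded_solution`). Such a point
respects the initial bounds and all later ones, and its entry is 0 wherever the bound falls below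
1/Δ. So the answer "infeasible" is given only when there is no feasible point. -/

@[simp] lemma Cost.pure_val {α : Type} (a : α) : (pure a : Cost α).val = a := rfl
@[simp] lemma Cost.bind_val {α β : Type} (x : Cost α) (f : α → Cost β) :
    (x >>= f).val = (f x.val).val := rfl
@[simp] lemma Cost.op_val {α : Type} (a : α) : (Cost.op a).val = a := rfl
@[simp] lemma Cost.call_val {α : Type} (x : Cost α) : x.call.val = x.val := rfl
@[simp] lemma Cost.vec_val {α : Type} {n : ℕ} (f : Fin n → Cost α) :
    (Cost.vec f).val = fun i => (f i).val := rfl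
@[simp] lemma Cost.ite_val {α : Type} (c : Prop) [Decidable c] (x y : Cost α) :
    (if c then x else y).val = if c then x.val else y.val := apply_ite Cost.val c x y

/-! ### Composition rules for operation and call counts -/

/-- The computation performs at most `k` operations and calls no subroutine. -/
def Cost.Within {α : Type} (x : Cost α) (k : ℕ) : Prop := x.ops ≤ k ∧ x.calls = 0

namespace Cost.Within

variable {α β : Type}

lemma mono {x : Cost α} {k l : ℕ} (h : x.Within k) (hkl : k ≤ l) : x.Within l :=
  ⟨h.1.trans hkl, h.2⟩

lemma pure (a : α) (k : ℕ) : (Pure.pure a : Cost α).Within k := ⟨Nat.zero_le _, rfl⟩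

lemma op (a : α) : (Cost.op a).Within 1 := ⟨le_rfl, rfl⟩

lemma bind {x : Cost α} {f : α → Cost β} {k l : ℕ} (hx : x.Within k)
    (hf : (f x.val).Within l) : (x >>= f).Within (k + l) :=
  ⟨Nat.add_le_add hx.1 hf.1, by
    change x.calls + (f x.val).calls = 0
    rw [hx.2, hf.2]⟩

lemma vec {n : ℕ} {f : Fin n → Cost α} {k : ℕ} (hf : ∀ i, (f i).Within k) :
    (Cost.vec f).Within (n * k) := by
  constructor
  · calc ∑ i, (f i).ops ≤ ∑ _i : Fin n, k := Finset.sum_le_sum fun i _ => (hf i).1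
      _ = n * k := by simp
  · change ∑ i, (f i).calls = 0
    exact Finset.sum_eq_zero fun i _ => (hf i).2

lemma ite {c : Prop} [Decidable c] {x y : Cost α} {k l : ℕ} (hx : x.Within k)
    (hy : y.Within l) : (if c then x else y).Within (max k l) := by
  split_ifs
  exacts [hx.mono (le_max_left _ _), hy.mono (le_max_right _ _)]

lemma find {p : α → Cost Bool} {k : ℕ} (hp : ∀ a, (p a).Within k) :
    ∀ l : List α, (Cost.find p l).Within (l.length * k)
  | [] => .pure _ _
  | a :: l => .mono (.bind (hp a) (.ite (.pure _ 0) (find hp l))) (by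
      simp only [List.length_cons, Nat.zero_le, max_eq_right]; ring_nf; rfl)

lemma filter {p : α → Cost Bool} {k : ℕ} (hp : ∀ a, (p a).Within k) :
    ∀ l : List α, (Cost.filter p l).Within (l.length * k)
  | [] => .pure _ _
  | a :: l => .mono (.bind (hp a) (.bind (filter hp l) (.pure _ 0))) (by
      simp only [List.length_cons]; ring_nf; rfl)

end Cost.Within

/-- The step of a loop performs at most `k` operations, or at most `k + l` if it is the last. -/
def Cost.StepWithin {σ α : Type} (x : Cost (σ ⊕ α)) (k l : ℕ) : Prop :=
  x.Within (k + l) ∧ ∀ s, x.val = Sum.inl s → x.Within k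

/-- The computation performs at most `k` operations and makes at most one call. -/
def Cost.WithinCall {α : Type} (x : Cost α) (k : ℕ) : Prop := x.ops ≤ k ∧ x.calls ≤ 1

namespace Cost.WithinCall

variable {α β : Type}

lemma mono {x : Cost α} {k l : ℕ} (h : x.WithinCall k) (hkl : k ≤ l) : x.WithinCall l :=
  ⟨h.1.trans hkl, h.2⟩

lemma of {x : Cost α} {k : ℕ} (h : x.Within k) : x.WithinCall k :=
  ⟨h.1, h.2.le.trans zero_le_one⟩

lemma bind {x : Cost α} {f : α → Cost β} {k l : ℕ} (hx : x.Within k)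
    (hf : (f x.val).WithinCall l) : (x >>= f).WithinCall (k + l) :=
  ⟨Nat.add_le_add hx.1 hf.1, by
    change x.calls + (f x.val).calls ≤ 1
    rw [hx.2, zero_add]
    exact hf.2⟩

lemma call_bind {x : Cost α} {f : α → Cost β} {k l : ℕ} (hx : x.Within k)
    (hf : (f x.val).Within l) : (x.call >>= f).WithinCall (k + l) :=
  ⟨Nat.add_le_add hx.1 hf.1, by
    change x.calls + 1 + (f x.val).calls ≤ 1
    rw [hx.2, hf.2]⟩

lemma ite {c : Prop} [Decidable c] {x y : Cost α} {k l : ℕ} (hx : x.WithinCall k)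
    (hy : y.WithinCall l) : (if c then x else y).WithinCall (max k l) := by
  split_ifs
  exacts [hx.mono (le_max_left _ _), hy.mono (le_max_right _ _)]

end Cost.WithinCall

namespace Cost.StepWithin

variable {α β σ : Type}

lemma mono {x : Cost (σ ⊕ α)} {k l k' l' : ℕ} (h : x.StepWithin k l) (hk : k ≤ k') (hl : l ≤ l') :
    x.StepWithin k' l' :=
  ⟨h.1.mono (by omega), fun s hs => (h.2 s hs).mono hk⟩

lemma bind {x : Cost β} {f : β → Cost (σ ⊕ α)} {k₁ k₂ l : ℕ} (hx : x.Within k₁)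
    (hf : (f x.val).StepWithin k₂ l) : (x >>= f).StepWithin (k₁ + k₂) l :=
  ⟨.mono (.bind hx hf.1) (by omega), fun s hs => .bind hx (hf.2 s hs)⟩

lemma ite {c : Prop} [Decidable c] {x y : Cost (σ ⊕ α)} {k₁ k₂ l₁ l₂ : ℕ}
    (hx : x.StepWithin k₁ l₁) (hy : y.StepWithin k₂ l₂) :
    (if c then x else y).StepWithin (max k₁ k₂) (max l₁ l₂) := by
  split_ifs
  exacts [hx.mono (le_max_left _ _) (le_max_left _ _),
    hy.mono (le_max_right _ _) (le_max_right _ _)]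

lemma more (s : σ) : (pure (Sum.inl s) : Cost (σ ⊕ α)).StepWithin 0 0 :=
  ⟨.pure _ _, fun _ _ => .pure _ _⟩

lemma last {x : Cost (σ ⊕ α)} {a : α} {l : ℕ} (hx : x.Within l) (h : x.val = Sum.inr a) :
    x.StepWithin 0 l :=
  ⟨hx.mono (by omega), fun s hs => by simp [h] at hs⟩

/-- Only the step that leaves the loop pays the surcharge `l`. In the Bubble loop `k` is linear and
`l` quadratic, so charging `l` at each of the 4n³ steps would cost a factor n. -/
lemma iterate {step : σ → Cost (σ ⊕ α)} {k l : ℕ} (hs : ∀ s, (step s).StepWithin k l) :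
    ∀ (j : ℕ) (s : σ), (Cost.iterate step j s).Within (j * k + l)
  | 0, _ => .pure _ _
  | j + 1, s => by
    rcases h : (step s).val with s₁ | a
    · refine .mono (.bind (l := j * k + l) ((hs s).2 _ h) ?_) (by rw [Nat.add_one_mul]; omega)
      rw [h]
      exact iterate hs j s₁
    · refine .mono (.bind (l := 0) (hs s).1 ?_) (by rw [Nat.add_one_mul]; omega)
      rw [h]
      exact .pure _ _

end Cost.StepWithin

/-- A machine each of whose instructions costs one operation. -/
structure Machine.UnitCost {R : Type} (M : Machine R) : Prop where
  const : ∀ k, (M.const k).Within 1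
  add : ∀ x y, (M.add x y).Within 1
  sub : ∀ x y, (M.sub x y).Within 1
  mul : ∀ x y, (M.mul x y).Within 1
  div : ∀ x y, (M.div x y).Within 1
  lt : ∀ x y, (M.lt x y).Within 1
  sqrt : ∀ x, (M.sqrt x).Within 1
  ceil : ∀ x, (M.ceil x).Within 1

lemma realMachine_unitCost : realMachine.UnitCost where
  const _ := .op _
  add _ _ := .op _
  sub _ _ := .op _
  mul _ _ := .op _
  div _ _ := .op _
  lt _ _ := .op _
  sqrt _ := .op _
  ceil _ := .op _

/-! ### Operation counts of the subroutines, on any machine with unit costs -/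

section CostBounds

variable {R : Type} {M : Machine R} {m n : ℕ}

open Cost Cost.Within

lemma length_of_eliminate {e : Fin n → R} {A : Fin m → Fin n → R} {b : Fin m → R} :
    ∀ {l : List (Fin m)} {B B' : List (Equation R m n)},
      (eliminate M e A b l B).val = Sum.inl B' → B'.length ≤ l.length + B.length
  | [], B, B', h => by
    obtain rfl : B = B' := Sum.inl.inj h
    simp
  | i :: l, B, B', h => by
    simp only [eliminate, Cost.bind_val, Cost.ite_val, Cost.pure_val] at h
    split_ifs at h
    all_goals
      have := length_of_eliminate h
      simp only [List.length_cons] at this ⊢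
      omega

lemma length_insertDesc (x : R) : ∀ l : List R, (insertDesc M x l).val.length = l.length + 1
  | [] => rfl
  | y :: l => by
    simp only [insertDesc, Cost.bind_val]
    split_ifs
    · rfl
    · simp [length_insertDesc x l]

lemma length_sortDesc : ∀ l : List R, (sortDesc M l).val.length = l.length
  | [] => rfl
  | x :: l => by
    rw [sortDesc, Cost.bind_val, length_insertDesc, length_sortDesc l, List.length_cons]

namespace Machine.UnitCost

variable (hM : M.UnitCost)
include hM

lemma sum_within : ∀ {n : ℕ} (x : Fin n → R), (sum M x).Within (n + 1)
  | 0, _ => hM.const 0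
  | _ + 1, _ => .bind (sum_within _) (hM.add _ _)

lemma dot_within (x y : Fin n → R) : (dot M x y).Within (2 * n + 1) :=
  .mono (.bind (.vec fun _ => hM.mul _ _) (hM.sum_within _)) (by omega)

lemma wdot_within (e x y : Fin n → R) : (wdot M e x y).Within (3 * n + 1) :=
  .mono (.bind (.vec fun _ => hM.mul _ _) (hM.dot_within _ _)) (by omega)

lemma addMul_within (x : Fin n → R) (c : R) (y : Fin n → R) : (addMul M x c y).Within (n * 2) :=
  .vec fun _ => .bind (hM.mul _ _) (hM.add _ _)

lemma subMul_within (x : Fin n → R) (c : R) (y : Fin n → R) : (subMul M x c y).Within (n * 2) :=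
  .vec fun _ => .bind (hM.mul _ _) (hM.sub _ _)

lemma smul_within (c : R) (x : Fin n → R) : (smul M c x).Within (n * 1) :=
  .vec fun _ => hM.mul _ _

lemma zeroVec_within (n : ℕ) : (zeroVec M n).Within (n * 1) := .vec fun _ => hM.const _

lemma unitVec_within (j : Fin n) : (unitVec M j).Within (n * 1) := .vec fun _ => hM.const _

lemma findNeg_within (x : Fin n → R) : (findNeg M x).Within (n * 2) :=
  .mono (.find (fun i => .bind (hM.const 0) (hM.lt _ _)) _) (by simp)

lemma invD_within (u : Fin n → R) : (invD M u).Within (n * 3) :=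
  .vec fun _ => .mono (.bind (hM.mul _ _) (.bind (hM.const _) (hM.div _ _))) (by omega)

lemma reduce_within (e : Fin n → R) : ∀ (l : List (Equation R m n)) (q : Equation R m n),
    (reduce M e l q).Within (l.length * (5 * n + 2 * m + 4) + (3 * n + 1))
  | [], _ => .mono (.bind (hM.wdot_within _ _ _) (.pure _ 0)) (by simp)
  | p :: l, q => .mono (.bind (hM.wdot_within _ _ _) <| .bind (hM.div _ _) <|
      .bind (hM.subMul_within _ _ _) <| .bind (hM.mul _ _) <| .bind (hM.sub _ _) <|
      .bind (hM.subMul_within _ _ _) (reduce_within e l _)) (by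
        have := Nat.add_one_mul l.length (5 * n + 2 * m + 4)
        simp only [List.length_cons]; omega)

/-- `N` bounds the number of stored equations throughout the recursion: each processed row leaves
`l` and adds at most one equation to `B`. -/
lemma eliminate_within (e : Fin n → R) (A : Fin m → Fin n → R) (b : Fin m → R) :
    ∀ (l : List (Fin m)) (B : List (Equation R m n)) (N : ℕ), l.length + B.length ≤ N →
      (eliminate M e A b l B).Within
        (l.length * (N * (5 * n + 2 * m + 4) + 3 * n + 5 * m + 6))
  | [], B, N, _ => .pure _ _
  | i :: l, B, N, h => by
    simp only [List.length_cons] at h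
    have hB : B.length * (5 * n + 2 * m + 4) ≤ N * (5 * n + 2 * m + 4) :=
      Nat.mul_le_mul_right _ (by omega)
    have key := Nat.add_one_mul l.length (N * (5 * n + 2 * m + 4) + 3 * n + 5 * m + 6)
    have h₁ : ∀ q, (eliminate M e A b l (q :: B)).Within _ := fun q =>
      eliminate_within e A b l (q :: B) N (by simp only [List.length_cons]; omega)
    have h₂ := eliminate_within e A b l B N (by omega)
    refine .mono (.bind (hM.const 0) <| .bind (hM.unitVec_within i) <|
      .bind (hM.reduce_within e B _) <| .bind (hM.lt _ _) <| .ite (h₁ _) <| .bind (hM.lt _ _) <|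
      .ite (.pure _ 0) <| .bind (hM.lt _ _) <| .ite (.bind (hM.zeroVec_within m) <|
      .bind (hM.const 1) <| .bind (hM.subMul_within _ _ _) (.pure _ 0)) h₂) ?_
    rw [List.length_cons, key]
    omega

lemma combine_within {coef : Equation R m n → Cost R} {k : ℕ} (hc : ∀ p, (coef p).Within k) :
    ∀ l : List (Equation R m n), (combine M coef l).Within (l.length * (k + 2 * m) + m)
  | [] => .mono (hM.zeroVec_within m) (by simp)
  | p :: l => .mono (.bind (combine_within hc l) <| .bind (hc p) (hM.addMul_within _ _ _)) (by
      have := Nat.add_one_mul l.length (k + 2 * m)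
      simp only [List.length_cons]; omega)

lemma closestMult_within (B : List (Equation R m n)) :
    (closestMult M B).Within (B.length * (1 + 2 * m) + m) :=
  hM.combine_within (fun _ => hM.div _ _) B

lemma scaledMul_within (e : Fin n → R) (A : Fin m → Fin n → R) (v : Fin m → R) :
    (scaledMul M e A v).Within (n * (2 * m + 2)) :=
  .vec fun _ => .mono (.bind (hM.dot_within _ _) (hM.mul _ _)) (by omega)

lemma normalMult_within (e : Fin n → R) (B : List (Equation R m n)) (j : Fin n) :
    (normalMult M e B j).Within (B.length * (4 + 2 * m) + m) :=
  hM.combine_within (fun _ => .mono (.bind (hM.const 0) <| .bind (hM.mul _ _) <|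
    .bind (hM.div _ _) (hM.sub _ _)) (by omega)) B

lemma normalVec_within (e : Fin n → R) (A : Fin m → Fin n → R) (j : Fin n) (v : Fin m → R) :
    (normalVec M e A j v).Within (n * (2 * m + 4)) :=
  .mono (.bind (hM.unitVec_within j) <| .vec fun _ => .bind (hM.dot_within _ _) <|
    .bind (hM.add _ _) (hM.mul _ _)) (by
      rw [show 2 * m + 4 = 1 + (2 * m + 1 + (1 + 1)) + 0 by omega]; ring_nf; omega)

lemma setup_within (A : Fin m → Fin n → R) (b : Fin m → R) (u e : Fin n → R)
    (B : List (Equation R m n)) {N : ℕ} (hm : m ≤ N) (hn : n ≤ N) (hB : B.length ≤ N) :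
    (setup M A b u e B).Within (50 * (N + 1) ^ 3) := by
  refine .mono (.bind (hM.closestMult_within B) <| .bind (hM.scaledMul_within e A _) <|
    .bind (hM.dot_within _ _) <| .bind (.vec fun j => hM.normalMult_within e B j) <|
    .bind (.vec fun j => hM.normalVec_within e A j _) <|
    .bind (.vec fun j => .bind (hM.const _) <| .bind (hM.div _ _) (hM.sub _ _)) (.pure _ 0)) ?_
  calc _ ≤ N * (1 + 2 * N) + N + (N * (2 * N + 2) + (2 * N + 1 + (N * (N * (4 + 2 * N) + N)
        + (N * (N * (2 * N + 4)) + (N * (1 + (1 + 1)) + 0))))) := by gcongr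
    _ ≤ _ := by ring_nf; nlinarith [Nat.zero_le (N ^ 3), Nat.zero_le (N ^ 2)]

lemma addComb_within (x : Fin m → R) (lam : Fin n → R) (V : Fin n → Fin m → R) :
    (addComb M x lam V).Within (m * (2 * n + 2)) :=
  .vec fun _ => .mono (.bind (hM.dot_within _ _) (hM.add _ _)) (by omega)

lemma stateCert_within (S : Setup R m n) (s : BubbleState R n) :
    (stateCert M S s).Within (m * (2 * n + 2)) :=
  .mono (.bind (hM.addComb_within _ _ _) (.pure _ 0)) (by omega)

/-- A step that goes on only updates vectors of length n. The multipliers `v`, a combination of n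
vectors of length m, are assembled only on output. -/
lemma bubbleStep_within (S : Setup R m n) (s : BubbleState R n) :
    (bubbleStep M S s).StepWithin (12 * n + 18) ((m + n) * (2 * n + 5) + 1) := by
  have hz := Cost.Within.vec (fun j => hM.add (S.r j) (s.y j))
  have aux : (m + n) * (2 * n + 5) = m * (2 * n + 2) + 3 * m + n * (2 * n + 5) := by ring
  have aux' : n * (2 * n + 5) = n * (2 * n) + 5 * n := by ring
  refine .mono (.bind (hM.add _ _) <| .bind (hM.const _) <| .bind (hM.lt _ _) <| .ite
    (.last (.bind (hM.stateCert_within S s) (.pure _ 0)) rfl)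
    (k₂ := 11 * n + 15) (l₂ := (m + n) * (2 * n + 5) + 1) <|
    .mono (.bind hz <| .bind (hM.findNeg_within _) (k₂ := 8 * n + 15)
      (l := (m + n) * (2 * n + 5) + 1) ?_) (by omega) le_rfl) (by omega) (by omega)
  split
  · exact .mono (.last (.pure _ 0) rfl) (by omega) (by omega)
  · exact .mono (.bind (hM.const _) <| .bind (hM.mul _ _) <| .bind (hM.mul _ _) <|
      .bind (hM.sub _ _) <| .bind (hM.unitVec_within _) <| .bind (hM.lt _ _) <| .ite
      (.bind (hM.sub _ _) <| .bind (hM.mul _ _) <| .bind (hM.div _ _) <| .bind (hM.mul _ _) <|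
        .bind (hM.sub _ _) <| .bind (hM.div _ _) <| .bind (hM.smul_within _ _) <|
        .bind (hM.addMul_within _ _ _) <| .bind (hM.smul_within _ _) <|
        .bind (hM.addMul_within _ _ _) <| .bind (hM.mul _ _) <| .bind (hM.mul _ _) <|
        .bind (hM.add _ _) <| .more _)
      (.last (.bind (hM.div _ _) <| .bind (hM.subMul_within _ _ _) <|
        .bind (hM.zeroVec_within m) <| .bind (hM.addComb_within _ _ _) <| .pure _ 0) rfl))
      (by omega) (by omega)

lemma sqDist_within (S : Setup R m n) (j : Fin n) : (sqDist M S j).Within 2 :=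
  .mono (.bind (hM.mul _ _) (hM.div _ _)) le_rfl

lemma farthest_within (S : Setup R m n) : ∀ (l : List (Fin n)) (best : Fin n × R),
    (farthest M S l best).Within (l.length * 5)
  | [], _ => .pure _ _
  | j :: l, _ => .mono (.bind (hM.const _) <| .bind (hM.lt _ _) <| .ite
      (.bind (hM.sqDist_within S j) <| .bind (hM.lt _ _) <| .ite (farthest_within S l _)
        (farthest_within S l _)) (farthest_within S l _)) (by
      simp only [List.length_cons]; omega)

lemma eliminate_finRange_within (e : Fin n → R) (A : Fin m → Fin n → R) (b : Fin m → R) {N : ℕ}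
    (hm : m ≤ N) (hn : n ≤ N) :
    (eliminate M e A b (List.finRange m) []).Within (20 * (N + 1) ^ 3) := by
  refine .mono (hM.eliminate_within e A b _ _ m (by simp)) ?_
  rw [List.length_finRange]
  calc _ ≤ N * (N * (5 * N + 2 * N + 4) + 3 * N + 5 * N + 6) := by gcongr
    _ ≤ _ := by ring_nf; nlinarith [Nat.zero_le (N ^ 3), Nat.zero_le (N ^ 2)]

lemma bubble_within (A : Fin m → Fin n → R) (b : Fin m → R) (u : Fin n → R) {N : ℕ}
    (hm : m ≤ N) (hn : n ≤ N) : (bubble M A b u).Within (300 * (N + 1) ^ 4) := by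
  refine .mono (.bind (hM.invD_within u) <| .bind (hM.eliminate_finRange_within _ A b hm hn)
    (l := 250 * (N + 1) ^ 4) ?_) ?_
  swap
  · calc _ ≤ N * 3 + (20 * (N + 1) ^ 3 + 250 * (N + 1) ^ 4) := by gcongr
      _ ≤ _ := by ring_nf; nlinarith [Nat.zero_le (N ^ 4), Nat.zero_le (N ^ 3), Nat.zero_le (N ^ 2)]
  rcases hE : (eliminate M (invD M u).val A b (List.finRange m) []).val with B | v
  swap
  · refine .mono (.bind (hM.zeroVec_within n) (.pure _ 0)) ?_
    calc _ ≤ N * 1 + 0 := by gcongr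
      _ ≤ _ := by ring_nf; nlinarith [Nat.zero_le (N ^ 4), Nat.zero_le (N ^ 3), Nat.zero_le (N ^ 2)]
  have hB : B.length ≤ N := (length_of_eliminate hE).trans (by simpa using hm)
  refine .mono (.bind (hM.setup_within A b u _ B hm hn hB) <| .bind (hM.const _) <|
    .bind (hM.lt _ _) <| .ite (.bind (hM.zeroVec_within n) (.pure _ 0)) <|
    .bind (hM.findNeg_within _) (l := 190 * (N + 1) ^ 4) ?_) ?_
  swap
  · calc _ ≤ 50 * (N + 1) ^ 3 + (1 + (1 + (N * 1 + 0 + (N * 2 + 190 * (N + 1) ^ 4)))) := by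
          gcongr
          exact max_le (le_trans (by gcongr) (Nat.le_add_right _ _))
            (le_trans (by gcongr) (Nat.le_add_left _ _))
      _ ≤ _ := by ring_nf; nlinarith [Nat.zero_le (N ^ 4), Nat.zero_le (N ^ 3), Nat.zero_le (N ^ 2)]
  split
  · exact .pure _ _
  refine .mono (.bind (hM.const 0) <| .bind (.find (fun j => .bind (hM.lt _ _) <|
    .bind (hM.lt _ _) (.pure _ 0)) _) (l := 180 * (N + 1) ^ 4) ?_) ?_
  swap
  · rw [List.length_finRange]
    calc _ ≤ 1 + (N * (1 + (1 + 0)) + 180 * (N + 1) ^ 4) := by gcongr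
      _ ≤ _ := by ring_nf; nlinarith [Nat.zero_le (N ^ 4), Nat.zero_le (N ^ 3), Nat.zero_le (N ^ 2)]
  split
  · refine .mono (.bind (hM.unitVec_within _) (.pure _ 0)) ?_
    calc _ ≤ N * 1 + 0 := by gcongr
      _ ≤ _ := by ring_nf; nlinarith [Nat.zero_le (N ^ 4), Nat.zero_le (N ^ 3), Nat.zero_le (N ^ 2)]
  refine .mono (.bind (hM.sqDist_within _ _) <| .bind (hM.farthest_within _ _ _) <|
    .bind (hM.div _ _) <| .bind (hM.unitVec_within _) <| .bind (hM.smul_within _ _) <|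
    .bind (hM.smul_within _ _) <|
    -- This is the dominant term: 4n³ + 1 steps of linear cost. The work before the loop is at most
    -- cubic.
    .bind (Cost.StepWithin.iterate (fun s => hM.bubbleStep_within _ s) _ _)
      (l := m * (2 * n + 2)) ?_) ?_
  swap
  · rw [List.length_finRange]
    calc _ ≤ 2 + (N * 5 + (1 + (N * 1 + (N * 1 + (N * 1 + ((4 * N ^ 3 + 1) * (12 * N + 18) +
          ((N + N) * (2 * N + 5) + 1) + N * (2 * N + 2))))))) := by gcongr
      _ ≤ _ := by ring_nf; nlinarith [Nat.zero_le (N ^ 4), Nat.zero_le (N ^ 3), Nat.zero_le (N ^ 2)]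
  split
  · exact .pure _ _
  · exact hM.stateCert_within _ _

lemma insertDesc_within (x : R) : ∀ l : List R, (insertDesc M x l).Within l.length
  | [] => .pure _ _
  | y :: l => .mono (.bind (hM.lt _ _) <| .ite (.pure _ 0) <|
      .bind (insertDesc_within x l) (.pure _ 0)) (by simp only [List.length_cons]; omega)

lemma sortDesc_within : ∀ l : List R, (sortDesc M l).Within (l.length * l.length)
  | [] => .pure _ _
  | _ :: l => .mono (.bind (sortDesc_within l) (hM.insertDesc_within _ _)) (by
      rw [length_sortDesc, List.length_cons]; ring_nf; omega)

lemma prod_within : ∀ l : List R, (prod M l).Within (l.length + 1)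
  | [] => hM.const 1
  | _ :: l => .bind (prod_within l) (hM.mul _ _)

lemma delta_within (A : Fin m → Fin n → R) (b : Fin m → R) {N : ℕ} (hm : m ≤ N) (hn : n ≤ N) :
    (delta M A b).Within (20 * (N + 1) ^ 4) := by
  refine .mono (.bind (.vec fun _ => hM.dot_within _ _) <| .bind (hM.dot_within _ _) <|
    .bind (hM.sortDesc_within _) <| .bind (hM.prod_within _) (hM.sqrt _)) ?_
  rw [List.length_cons, List.length_ofFn]
  calc _ ≤ N * (2 * N + 1) + (2 * N + 1 + ((N + 1) * (N + 1) + ((N + 1) + 1))) := by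
        gcongr
        exact (List.length_take_le _ _).trans hm
    _ ≤ _ := by ring_nf; nlinarith [Nat.zero_le (N ^ 4), Nat.zero_le (N ^ 3), Nat.zero_le (N ^ 2)]

lemma extend_within {k : ℕ} (idx : Fin k → Fin n) (x : Fin k → R) :
    (extend M idx x).Within (n * 1) :=
  .vec fun _ => by
    split
    exacts [.pure _ _, hM.const 0]

lemma newBound_within {k : ℕ} (tot : R) (u w : Fin k → R) (j : Fin k) :
    (newBound M tot u w j).Within 6 :=
  .mono (.bind (hM.const 0) <| .bind (hM.lt _ _) <| .ite (.bind (hM.const _) <|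
    .bind (hM.mul _ _) <| .bind (hM.div _ _) <| .bind (hM.lt _ _) <| .ite (.pure _ 0)
    (.pure _ 0)) (.pure _ 0)) (by omega)

lemma roundUp_within (n : ℕ) (Δ x : R) : (roundUp M n Δ x).Within 5 :=
  .mono (.bind (hM.const _) <| .bind (hM.mul _ _) <| .bind (hM.mul _ _) <|
    .bind (hM.ceil _) (hM.div _ _)) (by omega)

lemma lpStep_within (rounding : Bool) (A : Fin m → Fin n → R) (b : Fin m → R) (Δ : R)
    (s : LPState R n) {N : ℕ} (hm : m ≤ N) (hn : n ≤ N) (hs : s.size ≤ N) :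
    (lpStep M rounding A b Δ s).WithinCall (400 * (N + 1) ^ 4) := by
  refine .mono (.bind (hM.invD_within _) <| .bind (hM.eliminate_finRange_within _ _ b hm hs)
    (l := 350 * (N + 1) ^ 4) ?_) ?_
  swap
  · calc _ ≤ N * 3 + (20 * (N + 1) ^ 3 + 350 * (N + 1) ^ 4) := by gcongr
      _ ≤ _ := by ring_nf; nlinarith [Nat.zero_le (N ^ 4), Nat.zero_le (N ^ 3), Nat.zero_le (N ^ 2)]
  split
  · exact .of (.pure _ _)
  rename_i B hE
  have hB : B.length ≤ N := (length_of_eliminate hE).trans (by simpa using hm)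
  have hx : ∀ x, (extend M s.idx x).Within (N * 1) := fun x => .mono (hM.extend_within _ _) (by omega)
  have hf : ∀ (u : Fin s.size → R) (x : R), (Cost.filter (fun j => do
      let t ← M.lt (u j) x
      pure (!t)) (List.finRange s.size)).Within (s.size * 1) := fun u x => by
    have := Cost.Within.filter (p := fun j => do
      let t ← M.lt (u j) x
      pure (!t)) (fun j => .bind (hM.lt (u j) x) (.pure _ 0)) (List.finRange s.size)
    rwa [List.length_finRange] at this
  refine .mono (.ite (.bind (hM.closestMult_within B) <| .bind (hM.scaledMul_within _ _ _) <|
    .bind (hM.findNeg_within _) (l := N * 1 + 0) ?_) <| .call_bind (hM.bubble_within _ b _ hm hs)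
    (l := 20 * (N + 1)) ?_) (max_le (le_trans (?_ : _ ≤ N * (1 + 2 * N) + N + (N * (2 * N + 2) +
      (N * 2 + (N * 1 + 0)))) ?_) ?_)
  · split
    · exact .of (.pure _ _)
    · exact .of (.bind (hx _) (.pure _ _))
  · split
    · exact .mono (.bind (hx _) (.pure _ 0)) (by omega)
    · refine .mono (.bind (hM.const 0) <| .bind (hM.dot_within _ _) <| .bind (hM.lt _ _) <|
        .ite (.bind (.vec fun j => hM.newBound_within _ _ _ j) <| .bind (hM.const 1) <|
        .bind (hM.div _ _) <| .bind (hf _ _) <|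
        .bind (k := s.size * 5) ?_ (.pure _ 0)) (.pure _ 0)) ?_
      · refine .mono (.ite (.vec fun j => hM.roundUp_within n Δ _) (.pure _ 0)) (by omega)
      · omega
  · gcongr
  · ring_nf; nlinarith [Nat.zero_le (N ^ 4), Nat.zero_le (N ^ 3), Nat.zero_le (N ^ 2)]
  · ring_nf; nlinarith [Nat.zero_le (N ^ 4), Nat.zero_le (N ^ 3), Nat.zero_le (N ^ 2)]

end Machine.UnitCost

end CostBounds

/-! ### Values computed in exact real arithmetic -/

section RealMachine

variable {m n : ℕ}

@[simp] lemma realMachine_const (k : ℕ) : (realMachine.const k).val = k := rfl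
@[simp] lemma realMachine_add (x y : ℝ) : (realMachine.add x y).val = x + y := rfl
@[simp] lemma realMachine_sub (x y : ℝ) : (realMachine.sub x y).val = x - y := rfl
@[simp] lemma realMachine_mul (x y : ℝ) : (realMachine.mul x y).val = x * y := rfl
@[simp] lemma realMachine_div (x y : ℝ) : (realMachine.div x y).val = x / y := rfl
@[simp] lemma realMachine_lt (x y : ℝ) : (realMachine.lt x y).val = true ↔ x < y := by
  simp [realMachine]
@[simp] lemma realMachine_lt_eq_false (x y : ℝ) : (realMachine.lt x y).val = false ↔ y ≤ x := by
  simp [realMachine]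
@[simp] lemma realMachine_sqrt (x : ℝ) : (realMachine.sqrt x).val = √x := rfl
@[simp] lemma realMachine_ceil (x : ℝ) : (realMachine.ceil x).val = ⌈x⌉ := rfl

@[simp] lemma sum_val : ∀ {n : ℕ} (x : Fin n → ℝ), (sum realMachine x).val = ∑ i, x i
  | 0, _ => by simp [sum]
  | _ + 1, x => by simp [sum, sum_val, Fin.sum_univ_castSucc]

@[simp] lemma dot_val (x y : Fin n → ℝ) : (dot realMachine x y).val = ∑ i, x i * y i := by
  simp [dot]

@[simp] lemma wdot_val (e x y : Fin n → ℝ) :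
    (wdot realMachine e x y).val = ∑ i, e i * x i * y i := by
  simp [wdot]

@[simp] lemma addMul_val (x : Fin n → ℝ) (c : ℝ) (y : Fin n → ℝ) :
    (addMul realMachine x c y).val = x + c • y := rfl

@[simp] lemma subMul_val (x : Fin n → ℝ) (c : ℝ) (y : Fin n → ℝ) :
    (subMul realMachine x c y).val = x - c • y := rfl

@[simp] lemma smul_val (c : ℝ) (x : Fin n → ℝ) : (smul realMachine c x).val = c • x := rfl

@[simp] lemma zeroVec_val (n : ℕ) : (zeroVec realMachine n).val = 0 := by
  ext; simp [zeroVec]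

@[simp] lemma unitVec_val (j : Fin n) : (unitVec realMachine j).val = Pi.single j 1 := by
  ext i; simp [unitVec, Pi.single_apply]

lemma Cost.find_val_some {α : Type} {p : α → Cost Bool} {a : α} :
    ∀ {l : List α}, (Cost.find p l).val = some a → a ∈ l ∧ (p a).val = true
  | [], h => by simp [Cost.find] at h
  | b :: l, h => by
    simp only [Cost.find, bind_val, ite_val, pure_val] at h
    split_ifs at h with hb
    · obtain rfl : b = a := Option.some.inj h
      exact ⟨List.mem_cons_self, hb⟩
    · exact (find_val_some h).imp_left (List.mem_cons_of_mem _)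

lemma Cost.find_val_none {α : Type} {p : α → Cost Bool} {a : α} :
    ∀ {l : List α}, (Cost.find p l).val = none → a ∈ l → (p a).val = false
  | b :: l, h, ha => by
    simp only [Cost.find, bind_val, ite_val, pure_val] at h
    split_ifs at h with hb
    rcases List.mem_cons.1 ha with rfl | ha
    · simpa using hb
    · exact find_val_none h ha

lemma Cost.filter_val {α : Type} (p : α → Cost Bool) :
    ∀ l : List α, (Cost.filter p l).val = l.filter fun a => (p a).val
  | [] => rfl
  | a :: l => by simp [Cost.filter, filter_val p l, List.filter_cons]

lemma findNeg_some {x : Fin n → ℝ} {i : Fin n} (h : (findNeg realMachine x).val = some i) :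
    x i < 0 := by
  simpa using (Cost.find_val_some h).2

lemma findNeg_none {x : Fin n → ℝ} (h : (findNeg realMachine x).val = none) (i : Fin n) :
    0 ≤ x i := by
  simpa using Cost.find_val_none h (List.mem_finRange i)

lemma invD_val (u : Fin n → ℝ) : (invD realMachine u).val = fun i => u i * u i / 4 := by
  simp [invD]

end RealMachine

/-! ### Orthogonal elimination -/

section Elimination

variable {m n : ℕ} {e : Fin n → ℝ} {A : Fin m → Fin n → ℝ} {b : Fin m → ℝ}

/-- The inner product with weights `e`. -/
def weighted (e x y : Fin n → ℝ) : ℝ := ∑ i, e i * x i * y i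

lemma weighted_comm (e x y : Fin n → ℝ) : weighted e x y = weighted e y x :=
  Finset.sum_congr rfl fun _ _ => by ring

lemma weighted_sub_smul (e f x y : Fin n → ℝ) (c : ℝ) :
    weighted e f (x - c • y) = weighted e f x - c * weighted e f y := by
  simp only [weighted, Pi.sub_apply, Pi.smul_apply, smul_eq_mul, Finset.mul_sum,
    ← Finset.sum_sub_distrib]
  exact Finset.sum_congr rfl fun _ _ => by ring

lemma eq_zero_of_weighted_self_nonpos (he : ∀ i, 0 < e i) {x : Fin n → ℝ}
    (h : weighted e x x ≤ 0) : x = 0 := by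
  have h0 : ∀ i ∈ Finset.univ, 0 ≤ e i * x i * x i := fun i _ => by
    rw [mul_assoc]; exact mul_nonneg (he i).le (mul_self_nonneg _)
  ext i
  have := (Finset.sum_eq_zero_iff_of_nonneg h0).1 (le_antisymm h (Finset.sum_nonneg h0)) i
    (Finset.mem_univ i)
  simpa [(he i).ne'] using this

/-- The equation is the combination of the equations `A x = b` with its multipliers. -/
structure Equation.IsComb (A : Fin m → Fin n → ℝ) (b : Fin m → ℝ) (q : Equation ℝ m n) :
    Prop where
  row : ∀ j, q.row j = ∑ i, A i j * q.mult i
  rhs : q.rhs = ∑ i, b i * q.mult i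

lemma Equation.IsComb.row_dot {q : Equation ℝ m n} (hq : q.IsComb A b) (x : Fin n → ℝ) :
    ∑ j, q.row j * x j = ∑ i, q.mult i * ∑ j, A i j * x j := by
  simp only [hq.row, Finset.sum_mul, Finset.mul_sum]
  rw [Finset.sum_comm]
  exact Finset.sum_congr rfl fun _ _ => Finset.sum_congr rfl fun _ _ => by ring

/-- An orthogonal system of nontrivial equations that follow from `A x = b`. -/
structure IsOrthogonal (e : Fin n → ℝ) (A : Fin m → Fin n → ℝ) (b : Fin m → ℝ)
    (B : List (Equation ℝ m n)) : Prop where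
  isComb : ∀ p ∈ B, p.IsComb A b
  nrm : ∀ p ∈ B, p.nrm = weighted e p.row p.row
  pos : ∀ p ∈ B, 0 < p.nrm
  orthogonal : B.Pairwise fun p q => weighted e p.row q.row = 0

/-- `x` is a solution of `p.row ⬝ x = τ * p.rhs`. -/
def Equation.Holds (p : Equation ℝ m n) (τ : ℝ) (x : Fin n → ℝ) : Prop :=
  ∑ j, p.row j * x j = τ * p.rhs

lemma IsOrthogonal.tail {p : Equation ℝ m n} {B : List (Equation ℝ m n)}
    (h : IsOrthogonal e A b (p :: B)) : IsOrthogonal e A b B where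
  isComb q hq := h.isComb q (List.mem_cons_of_mem _ hq)
  nrm q hq := h.nrm q (List.mem_cons_of_mem _ hq)
  pos q hq := h.pos q (List.mem_cons_of_mem _ hq)
  orthogonal := h.orthogonal.of_cons

/-- Gram–Schmidt against an orthogonal list. The clause on `f` serves the induction: the head of the
list, once `q` has been made orthogonal to it, stays orthogonal while the tail is subtracted. The
last clause undoes the subtractions. The factor `τ` lets one statement serve `A x = b` (`τ = 1`) and
the kernel (`τ = 0`). -/
lemma reduce_spec : ∀ {B : List (Equation ℝ m n)} {q : Equation ℝ m n},
    IsOrthogonal e A b B → q.IsComb A b →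
    let q' := (reduce realMachine e B q).val
    q'.IsComb A b ∧ q'.nrm = weighted e q'.row q'.row ∧
      (∀ f, weighted e f q.row = 0 → (∀ p ∈ B, weighted e f p.row = 0) →
        weighted e f q'.row = 0) ∧
      (∀ p ∈ B, weighted e p.row q'.row = 0) ∧
      (∀ τ x, (∀ p ∈ B, p.Holds τ x) → q'.Holds τ x → q.Holds τ x)
  | [], q, _, hq => by
    refine ⟨⟨hq.row, hq.rhs⟩, ?_, ?_, ?_, ?_⟩ <;> simp [reduce, weighted, Equation.Holds]
  | p :: B, q, hB, hq => by
    set c := weighted e p.row q.row / p.nrm with hc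
    set q₁ : Equation ℝ m n :=
      ⟨q.row - c • p.row, q.rhs - c * p.rhs, q.mult - c • p.mult, q.nrm⟩ with hq₁
    have hred : (reduce realMachine e (p :: B) q).val = (reduce realMachine e B q₁).val := by
      simp [reduce, hq₁, hc, weighted]
    have hp := hB.isComb p List.mem_cons_self
    have hcomb : q₁.IsComb A b := by
      constructor
      · intro j
        simp only [hq₁, Pi.sub_apply, Pi.smul_apply, smul_eq_mul, hq.row j, hp.row j, Finset.mul_sum,
          ← Finset.sum_sub_distrib]
        exact Finset.sum_congr rfl fun _ _ => by ring
      · simp only [hq₁, Pi.sub_apply, Pi.smul_apply, smul_eq_mul, hq.rhs, hp.rhs, Finset.mul_sum,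
          ← Finset.sum_sub_distrib]
        exact Finset.sum_congr rfl fun _ _ => by ring
    obtain ⟨h₁, h₂, h₃, h₄, h₅⟩ := reduce_spec hB.tail hcomb
    rw [hred]
    refine ⟨h₁, h₂, fun f hf hfB => h₃ f ?_ fun p' hp' => hfB p' (List.mem_cons_of_mem _ hp'),
      fun p' hp' => ?_, fun τ x hx hq' => ?_⟩
    · simp [hq₁, weighted_sub_smul, hf, hfB p List.mem_cons_self]
    · rcases List.mem_cons.1 hp' with rfl | hp'
      · refine h₃ _ ?_ (List.pairwise_cons.1 hB.orthogonal).1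
        simp only [hq₁, weighted_sub_smul, hc]
        rw [← hB.nrm _ List.mem_cons_self, div_mul_cancel₀ _ (hB.pos _ List.mem_cons_self).ne',
          sub_self]
      · exact h₄ p' hp'
    · have h := h₅ τ x (fun p' hp' => hx p' (List.mem_cons_of_mem _ hp')) hq'
      have hpx := hx p List.mem_cons_self
      simp only [Equation.Holds, hq₁, Pi.sub_apply, Pi.smul_apply, smul_eq_mul, sub_mul,
        Finset.sum_sub_distrib, mul_assoc, ← Finset.mul_sum] at h hpx ⊢
      rw [hpx] at h
      linarith

lemma eliminate_spec (he : ∀ i, 0 < e i) : ∀ {l : List (Fin m)} {B : List (Equation ℝ m n)},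
    IsOrthogonal e A b B →
    (∀ B', (eliminate realMachine e A b l B).val = Sum.inl B' →
      IsOrthogonal e A b B' ∧ ∀ τ x, (∀ p ∈ B', p.Holds τ x) →
        (∀ p ∈ B, p.Holds τ x) ∧ ∀ i ∈ l, ∑ j, A i j * x j = τ * b i) ∧
    ∀ v, (eliminate realMachine e A b l B).val = Sum.inr v →
      ¬ ∃ x : Fin n → ℝ, ∀ i, ∑ j, A i j * x j = b i
  | [], B, hB => by
    constructor
    · rintro B' h
      obtain rfl : B = B' := Sum.inl.inj h
      exact ⟨hB, fun τ x h => ⟨h, by simp⟩⟩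
    · intro v h
      exact absurd h (by simp [eliminate])
  | i :: l, B, hB => by
    set q₀ : Equation ℝ m n := ⟨A i, b i, Pi.single i 1, 0⟩ with hq₀
    have hc₀ : q₀.IsComb A b := ⟨fun j => by simp [hq₀, Pi.single_apply],
      by simp [hq₀, Pi.single_apply]⟩
    obtain ⟨h₁, h₂, -, h₄, h₅⟩ := reduce_spec hB hc₀
    set q := (reduce realMachine e B q₀).val with hq
    have hcons : 0 < q.nrm → IsOrthogonal e A b (q :: B) := fun hpos =>
      { isComb := List.forall_mem_cons.2 ⟨h₁, hB.isComb⟩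
        nrm := List.forall_mem_cons.2 ⟨h₂, hB.nrm⟩
        pos := List.forall_mem_cons.2 ⟨hpos, hB.pos⟩
        orthogonal := List.pairwise_cons.2
          ⟨fun p hp => by rw [weighted_comm]; exact h₄ p hp, hB.orthogonal⟩ }
    have hval : (eliminate realMachine e A b (i :: l) B).val =
        if 0 < q.nrm then (eliminate realMachine e A b l (q :: B)).val
        else if 0 < q.rhs then Sum.inr q.mult
        else if q.rhs < 0 then Sum.inr (0 - (1 : ℝ) • q.mult)
        else (eliminate realMachine e A b l B).val := by
      simp [eliminate, hq, hq₀]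
    rw [hval]
    split_ifs with hn hr hr'
    · obtain ⟨ih₁, ih₂⟩ := eliminate_spec he (l := l) (hcons hn)
      refine ⟨fun B' hB' => ⟨(ih₁ B' hB').1, fun τ x hx => ?_⟩, ih₂⟩
      have := (ih₁ B' hB').2 τ x hx
      rw [List.forall_mem_cons] at this ⊢
      exact ⟨this.1.2, h₅ τ x this.1.2 this.1.1, this.2⟩
    all_goals
      have hrow : q.row = 0 := eq_zero_of_weighted_self_nonpos he (h₂ ▸ not_lt.1 hn)
      -- A vanishing row means that the multipliers combine the equations to `0 = q.rhs`: redundant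
      -- if the right side is 0, contradictory otherwise.
      have hsol : ∀ x : Fin n → ℝ, (∀ i, ∑ j, A i j * x j = b i) → q.rhs = 0 := fun x hx => by
        have := h₁.row_dot x
        simp only [hrow, hx, Pi.zero_apply, zero_mul, Finset.sum_const_zero] at this
        rw [h₁.rhs, this]
        exact Finset.sum_congr rfl fun _ _ => mul_comm _ _
    · exact ⟨fun _ h => by simp at h, fun _ _ ⟨x, hx⟩ => hr.ne' (hsol x hx)⟩
    · exact ⟨fun _ h => by simp at h, fun _ _ ⟨x, hx⟩ => hr'.ne (hsol x hx)⟩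
    · have hr0 : q.rhs = 0 := le_antisymm (not_lt.1 hr) (not_lt.1 hr')
      obtain ⟨ih₁, ih₂⟩ := eliminate_spec he (l := l) hB
      refine ⟨fun B' hB' => ⟨(ih₁ B' hB').1, fun τ x hx => ?_⟩, ih₂⟩
      have := (ih₁ B' hB').2 τ x hx
      rw [List.forall_mem_cons]
      exact ⟨this.1, h₅ τ x this.1 (by simp [Equation.Holds, hrow, hr0]), this.2⟩

lemma isOrthogonal_nil : IsOrthogonal e A b [] := ⟨by simp, by simp, by simp, .nil⟩

/-- The outcome of a successful elimination. -/
structure IsEliminated (e : Fin n → ℝ) (A : Fin m → Fin n → ℝ) (b : Fin m → ℝ)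
    (B : List (Equation ℝ m n)) : Prop extends IsOrthogonal e A b B where
  solves : ∀ τ x, (∀ p ∈ B, p.Holds τ x) → ∀ i, ∑ j, A i j * x j = τ * b i

lemma isEliminated_of_eliminate (he : ∀ i, 0 < e i) {B : List (Equation ℝ m n)}
    (h : (eliminate realMachine e A b (List.finRange m) []).val = Sum.inl B) :
    IsEliminated e A b B :=
  have := (eliminate_spec he isOrthogonal_nil).1 B h
  { this.1 with solves := fun τ x hx i => (this.2 τ x hx).2 i (List.mem_finRange i) }

lemma unsolvable_of_eliminate (he : ∀ i, 0 < e i) {v : Fin m → ℝ}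
    (h : (eliminate realMachine e A b (List.finRange m) []).val = Sum.inr v) :
    ¬ ∃ x : Fin n → ℝ, ∀ i, ∑ j, A i j * x j = b i :=
  (eliminate_spec he isOrthogonal_nil).2 v h

/-- `∑ p, coef p • p.row`. -/
def rowComb (coef : Equation ℝ m n → ℝ) (B : List (Equation ℝ m n)) (j : Fin n) : ℝ :=
  (B.map fun p => coef p * p.row j).sum

lemma sum_mul_combine {coef : Equation ℝ m n → Cost ℝ} (j : Fin n) :
    ∀ {B : List (Equation ℝ m n)}, (∀ p ∈ B, p.IsComb A b) →
      ∑ i, A i j * (combine realMachine coef B).val i = rowComb (fun p => (coef p).val) B j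
  | [], _ => by simp [combine, rowComb]
  | p :: B, h => by
    rw [List.forall_mem_cons] at h
    simp only [combine, Cost.bind_val, addMul_val, Pi.add_apply, Pi.smul_apply, smul_eq_mul,
      mul_add, Finset.sum_add_distrib, sum_mul_combine j h.2, rowComb, List.map_cons,
      List.sum_cons, h.1.row, Finset.mul_sum]
    rw [add_comm]
    congr 1
    exact Finset.sum_congr rfl fun _ _ => by ring

lemma weighted_rowComb (coef : Equation ℝ m n → ℝ) (f : Fin n → ℝ) :
    ∀ B : List (Equation ℝ m n),
      weighted e f (rowComb coef B) = (B.map fun p => coef p * weighted e f p.row).sum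
  | [] => by simp [weighted, rowComb]
  | p :: B => by
    have := weighted_rowComb coef f B
    simp only [weighted, rowComb, List.map_cons, List.sum_cons] at this ⊢
    rw [← this, Finset.mul_sum, ← Finset.sum_add_distrib]
    exact Finset.sum_congr rfl fun _ _ => by ring

/-- Orthogonality leaves only the term of `q`. Hence a point `D⁻¹ Aᵀ v` can be given any prescribed
values in the equations, one coefficient per equation. -/
lemma IsOrthogonal.weighted_rowComb (coef : Equation ℝ m n → ℝ) {q : Equation ℝ m n} :
    ∀ {B : List (Equation ℝ m n)}, IsOrthogonal e A b B → q ∈ B →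
      weighted e q.row (rowComb coef B) = coef q * q.nrm
  | p :: B, hB, hq => by
    have hpB := (List.pairwise_cons.1 hB.orthogonal).1
    rw [BubbleLP.weighted_rowComb, List.map_cons, List.sum_cons]
    rcases List.mem_cons.1 hq with rfl | hq
    · rw [← hB.nrm _ List.mem_cons_self, add_eq_left]
      refine List.sum_eq_zero fun x hx => ?_
      obtain ⟨p', hp', rfl⟩ := List.mem_map.1 hx
      rw [hpB p' hp', mul_zero]
    · rw [← BubbleLP.weighted_rowComb, hB.tail.weighted_rowComb coef hq, weighted_comm,
        hpB q hq, mul_zero, zero_add]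

end Elimination

/-! ### The geometry of the Bubble algorithm -/

section Geometry

variable {m n : ℕ} {e : Fin n → ℝ} {A : Fin m → Fin n → ℝ} {b : Fin m → ℝ} {u : Fin n → ℝ}

/-- The inner product of the `D`-norm, where `e` is the diagonal of `D⁻¹`. -/
noncomputable def dInner (e x y : Fin n → ℝ) : ℝ := ∑ i, x i * y i / e i

lemma dInner_comm (e x y : Fin n → ℝ) : dInner e x y = dInner e y x :=
  Finset.sum_congr rfl fun _ _ => by rw [mul_comm]

lemma dInner_add_right (e x y z : Fin n → ℝ) :
    dInner e x (y + z) = dInner e x y + dInner e x z := by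
  simp only [dInner, ← Finset.sum_add_distrib, Pi.add_apply]
  exact Finset.sum_congr rfl fun _ _ => by ring

lemma dInner_smul_right (e x y : Fin n → ℝ) (c : ℝ) :
    dInner e x (c • y) = c * dInner e x y := by
  simp only [dInner, Finset.mul_sum, Pi.smul_apply, smul_eq_mul]
  exact Finset.sum_congr rfl fun _ _ => by ring

lemma dInner_sub_right (e x y z : Fin n → ℝ) :
    dInner e x (y - z) = dInner e x y - dInner e x z := by
  rw [sub_eq_add_neg, dInner_add_right, ← neg_one_smul ℝ z, dInner_smul_right]
  ring

lemma dInner_add_left (e x y z : Fin n → ℝ) :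
    dInner e (x + y) z = dInner e x z + dInner e y z := by
  simp only [dInner_comm e _ z, dInner_add_right]

lemma dInner_smul_left (e x y : Fin n → ℝ) (c : ℝ) :
    dInner e (c • x) y = c * dInner e x y := by
  simp only [dInner_comm e _ y, dInner_smul_right]

lemma dInner_sub_left (e x y z : Fin n → ℝ) :
    dInner e (x - y) z = dInner e x z - dInner e y z := by
  simp only [dInner_comm e _ z, dInner_sub_right]

lemma sq_div_le_dInner_self (he : ∀ i, 0 < e i) (x : Fin n → ℝ) (i : Fin n) :
    x i ^ 2 / e i ≤ dInner e x x := by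
  rw [sq]
  exact Finset.single_le_sum (f := fun i => x i * x i / e i)
    (fun i _ => div_nonneg (mul_self_nonneg _) (he i).le) (Finset.mem_univ i)

lemma dInner_self_nonneg (he : ∀ i, 0 < e i) (x : Fin n → ℝ) : 0 ≤ dInner e x x :=
  Finset.sum_nonneg fun i _ => div_nonneg (mul_self_nonneg _) (he i).le

lemma eq_zero_of_dInner_self_nonpos (he : ∀ i, 0 < e i) {x : Fin n → ℝ}
    (h : dInner e x x ≤ 0) : x = 0 := by
  ext i
  have h1 := (sq_div_le_dInner_self he x i).trans h
  have h2 : x i ^ 2 ≤ 0 := by simpa using (div_le_iff₀ (he i)).1 h1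
  simpa using pow_eq_zero_iff two_ne_zero |>.1 (le_antisymm h2 (sq_nonneg _))

lemma two_mul_dInner_le (he : ∀ i, 0 < e i) (x y : Fin n → ℝ) :
    2 * dInner e x y ≤ dInner e x x + dInner e y y := by
  have := dInner_self_nonneg he (x - y)
  rw [dInner_sub_left, dInner_sub_right, dInner_sub_right, dInner_comm e y x] at this
  linarith

/-- `x` is in the kernel of `A`. -/
def Ker (A : Fin m → Fin n → ℝ) (x : Fin n → ℝ) : Prop := ∀ i, ∑ j, A i j * x j = 0

/-- `x` solves the equations `A x = b`. -/
def Solves (A : Fin m → Fin n → ℝ) (b : Fin m → ℝ) (x : Fin n → ℝ) : Prop :=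
  ∀ i, ∑ j, A i j * x j = b i

lemma Ker.add {x y : Fin n → ℝ} (hx : Ker A x) (hy : Ker A y) : Ker A (x + y) := fun i => by
  simp [mul_add, Finset.sum_add_distrib, hx i, hy i]

lemma Ker.smul {x : Fin n → ℝ} (c : ℝ) (hx : Ker A x) : Ker A (c • x) := fun i => by
  simp only [Pi.smul_apply, smul_eq_mul, mul_left_comm _ c, ← Finset.mul_sum, hx i, mul_zero]

lemma Ker.sub {x y : Fin n → ℝ} (hx : Ker A x) (hy : Ker A y) : Ker A (x - y) := fun i => by
  simp [mul_sub, Finset.sum_sub_distrib, hx i, hy i]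

lemma Solves.sub {x y : Fin n → ℝ} (hx : Solves A b x) (hy : Solves A b y) : Ker A (x - y) :=
  fun i => by simp [mul_sub, Finset.sum_sub_distrib, hx i, hy i]

lemma Solves.add {x y : Fin n → ℝ} (hx : Solves A b x) (hy : Ker A y) : Solves A b (x + y) :=
  fun i => by simp [mul_add, Finset.sum_add_distrib, hx i, hy i]

/-- `y` is the element of the kernel of `A` that represents the functional `w` there. -/
structure Represents (e : Fin n → ℝ) (A : Fin m → Fin n → ℝ) (y w : Fin n → ℝ) : Prop where
  ker : Ker A y
  dual : ∀ x, Ker A x → dInner e y x = ∑ j, w j * x j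

lemma Represents.add {y y' w w' : Fin n → ℝ} (h : Represents e A y w)
    (h' : Represents e A y' w') : Represents e A (y + y') (w + w') where
  ker := h.ker.add h'.ker
  dual x hx := by
    simp only [dInner_add_left, h.dual x hx, h'.dual x hx, Pi.add_apply, add_mul,
      Finset.sum_add_distrib]

lemma Represents.smul {y w : Fin n → ℝ} (c : ℝ) (h : Represents e A y w) :
    Represents e A (c • y) (c • w) where
  ker := h.ker.smul c
  dual x hx := by
    simp only [dInner_smul_left, h.dual x hx, Pi.smul_apply, smul_eq_mul, mul_assoc,
      Finset.mul_sum]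

lemma Represents.sub {y y' w w' : Fin n → ℝ} (h : Represents e A y w)
    (h' : Represents e A y' w') : Represents e A (y - y') (w - w') where
  ker := h.ker.sub h'.ker
  dual x hx := by
    simp only [dInner_sub_left, h.dual x hx, h'.dual x hx, Pi.sub_apply, sub_mul,
      Finset.sum_sub_distrib]

/-- What the initial computations of the Bubble algorithm achieve. -/
structure IsSetup (e : Fin n → ℝ) (A : Fin m → Fin n → ℝ) (b : Fin m → ℝ) (u : Fin n → ℝ)
    (S : Setup ℝ m n) : Prop where
  solves : Solves A b S.r
  perp : ∀ x, Ker A x → dInner e S.r x = 0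
  ρ_eq : S.ρ = dInner e S.r S.r
  represents : ∀ j, Represents e A (S.g j) (Pi.single j 1)
  c_eq : ∀ j, S.c j = u j / (2 * n) - S.r j

lemma sum_mul_sum_comm (A : Fin m → Fin n → ℝ) (v : Fin m → ℝ) (x : Fin n → ℝ) :
    ∑ j, (∑ i, A i j * v i) * x j = ∑ i, v i * ∑ j, A i j * x j := by
  simp only [Finset.sum_mul, Finset.mul_sum]
  rw [Finset.sum_comm]
  exact Finset.sum_congr rfl fun _ _ => Finset.sum_congr rfl fun _ _ => by ring

/-- The point computed from the eliminated system. -/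
lemma IsEliminated.closest (he : ∀ i, 0 < e i) {B : List (Equation ℝ m n)}
    (hB : IsEliminated e A b B) :
    let v := (closestMult realMachine B).val
    let r := (scaledMul realMachine e A v).val
    Solves A b r ∧ (∀ x, dInner e r x = ∑ i, v i * ∑ j, A i j * x j) := by
  intro v r
  have hr : r = fun j => e j * rowComb (fun p => p.rhs / p.nrm) B j := by
    ext j
    have := sum_mul_combine (coef := fun p => realMachine.div p.rhs p.nrm) j hB.isComb
    simp only [realMachine_div] at this
    simp [r, scaledMul, v, closestMult, ← this]
  refine ⟨fun i => ?_, fun x => ?_⟩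
  · rw [hB.solves 1 r _ i, one_mul]
    intro q hq
    have := hB.weighted_rowComb (fun p => p.rhs / p.nrm) hq
    rw [div_mul_cancel₀ _ (hB.pos q hq).ne'] at this
    rw [Equation.Holds, one_mul, ← this, hr, weighted]
    exact Finset.sum_congr rfl fun _ _ => by ring
  · rw [← sum_mul_sum_comm]
    refine Finset.sum_congr rfl fun j _ => ?_
    have := (he j).ne'
    simp only [r, scaledMul, Cost.vec_val, Cost.bind_val, dot_val, realMachine_mul]
    field_simp

/-- Paired with x in the D-inner product, `D⁻¹ (Aᵀ v + e^j)` gives `v ⬝ A x + x j`, which is `x j`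
on the kernel for any `v`. The coefficients of `normalMult` are needed only to bring the vector into
the kernel. -/
lemma IsEliminated.normal (he : ∀ i, 0 < e i) {B : List (Equation ℝ m n)}
    (hB : IsEliminated e A b B) (j : Fin n) :
    Represents e A (normalVec realMachine e A j (normalMult realMachine e B j).val).val
      (Pi.single j 1) := by
  set v := (normalMult realMachine e B j).val with hv
  set g := (normalVec realMachine e A j v).val with hg
  have hg' : g = fun k => e k * ((∑ i, A i k * v i) + Pi.single (M := fun _ => ℝ) j 1 k) := by
    simp [hg, normalVec]
  have hrow : ∀ k, ∑ i, A i k * v i = rowComb (fun p => 0 - e j * p.row j / p.nrm) B k := fun k => by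
    rw [hv, normalMult, sum_mul_combine k hB.isComb]
    simp
  constructor
  · intro i
    rw [hB.solves 0 g _ i, zero_mul]
    intro q hq
    have := hB.weighted_rowComb (fun p => 0 - e j * p.row j / p.nrm) hq
    rw [sub_mul, div_mul_cancel₀ _ (hB.pos q hq).ne'] at this
    rw [Equation.Holds, zero_mul, hg']
    simp only [hrow, mul_add, Finset.sum_add_distrib]
    -- This cancels the contribution `e j * q.row j` of the unit vector.
    have h2 : ∑ k, q.row k * (e k * rowComb (fun p => 0 - e j * p.row j / p.nrm) B k) =
        0 * q.nrm - e j * q.row j := by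
      rw [← this, weighted]
      exact Finset.sum_congr rfl fun _ _ => by ring
    rw [h2]
    simp [Pi.single_apply, mul_comm]
  · intro x hx
    have h1 : dInner e g x = ∑ k, ((∑ i, A i k * v i) + Pi.single (M := fun _ => ℝ) j 1 k) * x k := by
      refine Finset.sum_congr rfl fun k _ => ?_
      have := (he k).ne'
      simp only [hg']
      field_simp
    rw [h1]
    simp only [add_mul, Finset.sum_add_distrib, sum_mul_sum_comm, hx _, mul_zero,
      Finset.sum_const_zero, zero_add]

lemma IsEliminated.isSetup (he : ∀ i, 0 < e i) {B : List (Equation ℝ m n)}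
    (hB : IsEliminated e A b B) : IsSetup e A b u (setup realMachine A b u e B).val := by
  obtain ⟨h₁, h₂⟩ := hB.closest he
  refine ⟨h₁, fun x hx => ?_, ?_, fun j => hB.normal he j, fun j => ?_⟩
  · exact (h₂ x).trans (by simp [hx _])
  · refine Eq.trans ?_ (h₂ _).symm
    simp only [setup, Cost.bind_val, Cost.pure_val, dot_val]
    exact Finset.sum_congr rfl fun i _ => by rw [h₁ i, mul_comm]
  · simp [setup]

/-- Every feasible point below the bounds `u` satisfies `w ⬝ x < w ⬝ ℓ`. -/
structure IsCert (A : Fin m → Fin n → ℝ) (b : Fin m → ℝ) (u w : Fin n → ℝ) : Prop where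
  nonneg : ∀ j, 0 ≤ w j
  lt : ∀ x, Solves A b x → (∀ j, 0 ≤ x j) → (∀ j, x j ≤ u j) →
    ∑ j, w j * x j < ∑ j, w j * (u j / (2 * n))

/-- The outputs of the Bubble algorithm that are allowed. -/
def BubbleOut.Correct (A : Fin m → Fin n → ℝ) (b : Fin m → ℝ) (u : Fin n → ℝ) :
    BubbleOut ℝ m n → Prop
  | .point x => Solves A b x ∧ ∀ j, 0 ≤ x j
  | .cert _ w => IsCert A b u w

/-- The invariant of the while loop. -/
structure Invariant (e : Fin n → ℝ) (A : Fin m → Fin n → ℝ) (S : Setup ℝ m n)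
    (s : BubbleState ℝ n) : Prop where
  nonneg : ∀ j, 0 ≤ s.lam j
  represents : Represents e A s.y s.lam
  θ_eq : s.θ = dInner e s.y s.y
  θ_eq' : s.θ = ∑ j, s.lam j * S.c j
  θ_pos : 0 < s.θ
  le : ∀ i, 0 < S.c i → S.c i ^ 2 ≤ S.g i i * s.θ

variable {S : Setup ℝ m n} {s : BubbleState ℝ n}

/-- At `x = S.g j` this identifies `S.g j j` with the squared norm of `S.g j`, which is why the
algorithm can read norms off as coordinates. -/
lemma IsSetup.dInner_g (hS : IsSetup e A b u S) (j : Fin n) {x : Fin n → ℝ} (hx : Ker A x) :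
    dInner e (S.g j) x = x j := by
  rw [(hS.represents j).dual x hx]
  simp [Pi.single_apply]

/-- A box-feasible point has squared `D`-norm at most `4 n`. -/
lemma dInner_self_le_of_le (hu : ∀ j, 0 < u j) {x : Fin n → ℝ} (h0 : ∀ j, 0 ≤ x j)
    (hx : ∀ j, x j ≤ u j) : dInner (fun j => u j * u j / 4) x x ≤ 4 * n := by
  calc dInner (fun j => u j * u j / 4) x x ≤ ∑ _j : Fin n, (4 : ℝ) := by
        refine Finset.sum_le_sum fun j _ => ?_
        have := hu j
        rw [div_le_iff₀ (by positivity)]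
        nlinarith [h0 j, hx j]
    _ = 4 * n := by simp [mul_comm]

/-- A functional `w ≥ 0` that vanishes on the kernel, while `w ⬝ (ℓ - r) > 0`, is a certificate. -/
lemma IsSetup.isCert_of_zero (hS : IsSetup e A b u S) {w : Fin n → ℝ} (hw : ∀ j, 0 ≤ w j)
    (h0 : ∀ x, Ker A x → ∑ j, w j * x j = 0) (hc : 0 < ∑ j, w j * S.c j) : IsCert A b u w where
  nonneg := hw
  lt x hx _ _ := by
    have h := h0 _ (hx.sub hS.solves)
    simp only [hS.c_eq, Pi.sub_apply, mul_sub, Finset.sum_sub_distrib] at h hc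
    linarith

/-- A point of large norm yields a certificate. -/
lemma IsSetup.isCert_of_norm (hu : ∀ j, 0 < u j)
    (hS : IsSetup (fun j => u j * u j / 4) A b u S) {w y : Fin n → ℝ} (hw : ∀ j, 0 ≤ w j)
    (hy : Represents (fun j => u j * u j / 4) A y w)
    (hθ : dInner (fun j => u j * u j / 4) y y = ∑ j, w j * S.c j)
    (hlt : 4 * n < S.ρ + dInner (fun j => u j * u j / 4) y y) : IsCert A b u w where
  nonneg := hw
  lt x hx h0 hxu := by
    set e : Fin n → ℝ := fun j => u j * u j / 4 with he_def
    have he : ∀ j, 0 < e j := fun j => by have := hu j; simp only [he_def]; positivity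
    have hk := hx.sub hS.solves
    have h₁ := two_mul_dInner_le he (S.r + y) x
    have h₂ := dInner_self_le_of_le hu h0 hxu
    have h₃ := hS.perp _ hk
    have h₄ := hS.perp _ hy.ker
    have h₅ := hy.dual _ hk
    have h₆ := hS.ρ_eq
    rw [dInner_sub_right] at h₃ h₅
    rw [dInner_comm e y S.r, h₄] at h₅
    simp only [dInner_add_left, dInner_add_right, dInner_comm e y S.r, h₄] at h₁
    -- From 2⟨r + y, x⟩ ≤ ‖r + y‖² + ‖x‖² < 2‖r + y‖², where ⟨r, x⟩ = ‖r‖² drops out on both sides.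
    have h₇ : dInner e y x < dInner e y y := by linarith
    simp only [Pi.sub_apply, hS.c_eq, mul_sub, Finset.sum_sub_distrib] at h₅ hθ
    linarith

end Geometry

/-! ### Correctness of the Bubble algorithm -/

section Bubble

variable {m n : ℕ} {A : Fin m → Fin n → ℝ} {b : Fin m → ℝ} {u : Fin n → ℝ} {S : Setup ℝ m n}
  {s : BubbleState ℝ n}

/-- The coefficients of the minimum norm point on two tight constraints. -/
lemma Invariant.next {e : Fin n → ℝ} (he : ∀ j, 0 < e j) (hS : IsSetup e A b u S)
    (hs : Invariant e A S s) {i : Fin n} (hi : s.y i < S.c i)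
    (hdet : 0 < S.g i i * s.θ - s.y i * s.y i) {μ₁ μ₂ : ℝ}
    (h₁ : μ₁ = s.θ * (S.c i - s.y i) / (S.g i i * s.θ - s.y i * s.y i))
    (h₂ : μ₂ = (S.g i i * s.θ - s.y i * S.c i) / (S.g i i * s.θ - s.y i * s.y i)) :
    Invariant e A S ⟨μ₂ • s.lam + μ₁ • Pi.single i 1, μ₂ • s.y + μ₁ • S.g i,
      μ₁ * S.c i + μ₂ * s.θ⟩ ∧
      s.θ + (S.c i - s.y i) ^ 2 / e i ≤ μ₁ * S.c i + μ₂ * s.θ := by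
  have hθ := hs.θ_pos
  have hy := hs.represents.ker
  have hgy : dInner e (S.g i) s.y = s.y i := hS.dInner_g i hy
  have hgg : dInner e (S.g i) (S.g i) = S.g i i := hS.dInner_g i (hS.represents i).ker
  have hμ₁ : 0 ≤ μ₁ := by
    rw [h₁]
    exact div_nonneg (mul_nonneg hθ.le (by linarith)) hdet.le
  have hμ₂ : 0 ≤ μ₂ := by
    rw [h₂]
    -- The choice of the farthest first hyperplane enters here. If `S.c i > 0`, then y_i c_i ≤ c_i²
    -- ≤ g_ii θ by `hs.le`. If `S.c i ≤ 0`, then y_i < c_i ≤ 0 gives y_i c_i ≤ y_i² < g_ii θ.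
    refine div_nonneg ?_ hdet.le
    rcases le_or_gt (S.c i) 0 with hc | hc
    · nlinarith
    · nlinarith [hs.le i hc]
  -- `μ₁`, `μ₂` solve the 2 × 2 Gram system of `S.g i` and `s.y` that makes both constraints of K
  -- tight.
  have e₁ : μ₁ * s.y i + μ₂ * s.θ = s.θ := by
    rw [h₁, h₂, div_mul_eq_mul_div, div_mul_eq_mul_div, ← add_div, div_eq_iff hdet.ne']
    ring
  have e₂ : μ₁ * S.g i i + μ₂ * s.y i = S.c i := by
    rw [h₁, h₂, div_mul_eq_mul_div, div_mul_eq_mul_div, ← add_div, div_eq_iff hdet.ne']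
    ring
  set y' := μ₂ • s.y + μ₁ • S.g i with hy'
  have hrep : Represents e A y' (μ₂ • s.lam + μ₁ • Pi.single i 1) :=
    (hs.represents.smul μ₂).add ((hS.represents i).smul μ₁)
  have hyy' : dInner e s.y y' = s.θ := by
    rw [hy', dInner_add_right, dInner_smul_right, dInner_smul_right, ← hs.θ_eq,
      dInner_comm e s.y, hgy]
    linarith
  have hgy' : y' i = S.c i := by
    rw [← hS.dInner_g i hrep.ker, hy', dInner_add_right, dInner_smul_right, dInner_smul_right,
      hgy, hgg]
    linarith
  have hθ' : μ₁ * S.c i + μ₂ * s.θ = dInner e y' y' := by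
    conv_rhs => rw [hy', dInner_add_left, dInner_smul_left, dInner_smul_left, ← hy', hyy',
      hS.dInner_g i hrep.ker, hgy']
    ring
  -- Pythagoras: ⟨y, y'⟩ = ‖y‖² makes the gain equal to ‖y' - y‖², of which coordinate i alone is
  -- kept.
  have hprog : s.θ + (S.c i - s.y i) ^ 2 / e i ≤ μ₁ * S.c i + μ₂ * s.θ := by
    have h := sq_div_le_dInner_self he (y' - s.y) i
    rw [dInner_sub_left, dInner_sub_right, dInner_sub_right, dInner_comm e y' s.y, hyy',
      ← hs.θ_eq, ← hθ', Pi.sub_apply, hgy'] at h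
    linarith
  have hle : s.θ ≤ μ₁ * S.c i + μ₂ * s.θ :=
    le_trans (le_add_of_nonneg_right (div_nonneg (sq_nonneg _) (he i).le)) hprog
  refine ⟨⟨fun j => ?_, hrep, hθ', ?_, hθ.trans_le hle, fun j hj => ?_⟩, hprog⟩
  · have := hs.nonneg j
    have h1 : (0 : ℝ) ≤ Pi.single (M := fun _ => ℝ) i 1 j := by
      rw [Pi.single_apply]; split_ifs <;> norm_num
    simp only [Pi.add_apply, Pi.smul_apply, smul_eq_mul]
    positivity
  · simp only [Pi.add_apply, Pi.smul_apply, smul_eq_mul, add_mul, Finset.sum_add_distrib,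
      mul_assoc, ← Finset.mul_sum, ← hs.θ_eq']
    simp [Pi.single_apply, add_comm]
  · refine (hs.le j hj).trans (mul_le_mul_of_nonneg_left hle ?_)
    rw [← hS.dInner_g j (hS.represents j).ker]
    exact dInner_self_nonneg he _

/-- The certificate when the two constraints of `K` contradict each other. -/
lemma Invariant.isCert_of_dependent {e : Fin n → ℝ} (he : ∀ j, 0 < e j) (hS : IsSetup e A b u S)
    (hs : Invariant e A S s) {i : Fin n} (hi : s.y i < S.c i)
    (hdet : S.g i i * s.θ - s.y i * s.y i ≤ 0) :
    IsCert A b u (Pi.single i 1 - (s.y i / s.θ) • s.lam) := by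
  have hθ := hs.θ_pos
  have hy := hs.represents.ker
  have hgy : dInner e (S.g i) s.y = s.y i := hS.dInner_g i hy
  have hgg : dInner e (S.g i) (S.g i) = S.g i i := hS.dInner_g i (hS.represents i).ker
  -- Otherwise 0 < y_i < c_i, and y_i² < c_i² ≤ g_ii θ contradicts `hdet`. This sign makes the
  -- certificate nonnegative.
  have hneg : s.y i ≤ 0 := by
    by_contra! h
    nlinarith [hs.le i (h.trans hi)]
  have hrep := (hS.represents i).sub (hs.represents.smul (s.y i / s.θ))
  -- The equality case of Cauchy–Schwarz.
  have h0 : S.g i - (s.y i / s.θ) • s.y = 0 := by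
    refine eq_zero_of_dInner_self_nonpos he ?_
    simp only [dInner_sub_left, dInner_sub_right, dInner_smul_left, dInner_smul_right, hgy, hgg,
      dInner_comm e s.y (S.g i), ← hs.θ_eq]
    field_simp
    linarith
  refine hS.isCert_of_zero (fun j => ?_) (fun x hx => ?_) ?_
  · have h1 : (0 : ℝ) ≤ Pi.single (M := fun _ => ℝ) i 1 j := by
      rw [Pi.single_apply]; split_ifs <;> norm_num
    have h2 : s.y i / s.θ * s.lam j ≤ 0 :=
      mul_nonpos_of_nonpos_of_nonneg (div_nonpos_of_nonpos_of_nonneg hneg hθ.le) (hs.nonneg j)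
    simp only [Pi.sub_apply, Pi.smul_apply, smul_eq_mul]
    linarith
  · rw [← hrep.dual x hx, h0]
    simp [dInner]
  · simp only [Pi.sub_apply, Pi.smul_apply, smul_eq_mul, sub_mul, Finset.sum_sub_distrib,
      mul_assoc, ← Finset.mul_sum, ← hs.θ_eq']
    rw [div_mul_cancel₀ _ hθ.ne']
    simpa [Pi.single_apply] using hi

lemma bubbleStep_spec (hu : ∀ j, 0 < u j)
    (hS : IsSetup (fun j => u j * u j / 4) A b u S)
    (hs : Invariant (fun j => u j * u j / 4) A S s) :
    (∀ out, (bubbleStep realMachine S s).val = Sum.inr out → out.Correct A b u) ∧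
    ∀ s', (bubbleStep realMachine S s).val = Sum.inl s' →
      Invariant (fun j => u j * u j / 4) A S s' ∧ s.θ + 1 / (n : ℝ) ^ 2 ≤ s'.θ ∧
      S.ρ + s.θ ≤ 4 * n := by
  have he : ∀ j, 0 < u j * u j / 4 := fun j => by have := hu j; positivity
  by_cases hb : (4 * n : ℝ) < S.ρ + s.θ
  · have hval : ∃ v, (bubbleStep realMachine S s).val = Sum.inr (.cert v s.lam) :=
      ⟨_, by simp [bubbleStep, hb, stateCert]; rfl⟩
    obtain ⟨v, hv⟩ := hval
    rw [hv]
    refine ⟨?_, fun _ h => by simp at h⟩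
    rintro out ⟨⟩
    exact hS.isCert_of_norm hu hs.nonneg hs.represents (hs.θ_eq.symm.trans hs.θ_eq')
      (hs.θ_eq ▸ hb)
  · rcases hz : (findNeg realMachine (S.r + s.y)).val with _ | i
    · have hval : (bubbleStep realMachine S s).val = Sum.inr (.point (S.r + s.y)) := by
        have : (fun j => S.r j + s.y j) = S.r + s.y := rfl
        simp [bubbleStep, hb, this, hz]
      rw [hval]
      refine ⟨?_, fun _ h => by simp at h⟩
      rintro out ⟨⟩
      exact ⟨hS.solves.add hs.represents.ker, findNeg_none hz⟩
    · have hzi : S.r i + s.y i < 0 := findNeg_some hz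
      have hn : (0 : ℝ) < n := by exact_mod_cast i.pos
      have hui := hu i
      have hl : 0 < u i / (2 * n) := by positivity
      have hi : s.y i < S.c i := by rw [hS.c_eq]; linarith
      by_cases hdet : 0 < S.g i i * s.θ - s.y i * s.y i
      · have hdet' := sub_pos.1 hdet
        obtain ⟨μ₁, hμ₁⟩ : ∃ μ, μ = s.θ * (S.c i - s.y i) / (S.g i i * s.θ - s.y i * s.y i) :=
          ⟨_, rfl⟩
        obtain ⟨μ₂, hμ₂⟩ :
          ∃ μ, μ = (S.g i i * s.θ - s.y i * S.c i) / (S.g i i * s.θ - s.y i * s.y i) := ⟨_, rfl⟩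
        obtain ⟨h₁, h₂⟩ := hs.next he hS hi hdet hμ₁ hμ₂
        have hval : (bubbleStep realMachine S s).val = Sum.inl
            ⟨μ₂ • s.lam + μ₁ • Pi.single i 1, μ₂ • s.y + μ₁ • S.g i,
              μ₁ * S.c i + μ₂ * s.θ⟩ := by
          have : (fun j => S.r j + s.y j) = S.r + s.y := rfl
          simp [bubbleStep, hb, this, hz, hdet', hμ₁, hμ₂]
        rw [hval]
        refine ⟨fun _ h => by simp at h, ?_⟩
        rintro s' ⟨⟩
        refine ⟨h₁, le_trans (add_le_add le_rfl ?_) h₂, not_lt.1 hb⟩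
        -- As z_i < 0, c_i - y_i = ℓ_i - z_i exceeds u_i/(2n). Its square divided by u_i²/4 is at
        -- least 1/n².
        rw [hS.c_eq, div_le_div_iff₀ (by positivity) (he i)]
        have h3 : u i / (2 * n) ≤ u i / (2 * n) - S.r i - s.y i := by linarith
        have h4 : (u i / (2 * n)) ^ 2 ≤ (u i / (2 * n) - S.r i - s.y i) ^ 2 :=
          pow_le_pow_left₀ hl.le h3 2
        calc 1 * (u i * u i / 4) = (u i / (2 * n)) ^ 2 * n ^ 2 := by field_simp; norm_num
          _ ≤ _ := mul_le_mul_of_nonneg_right h4 (by positivity)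
      · have hdet' : ¬ s.y i * s.y i < S.g i i * s.θ := fun h => hdet (sub_pos.2 h)
        have hval : ∃ v, (bubbleStep realMachine S s).val =
            Sum.inr (.cert v (Pi.single i 1 - (s.y i / s.θ) • s.lam)) := by
          have : (fun j => S.r j + s.y j) = S.r + s.y := rfl
          exact ⟨_, by simp [bubbleStep, hb, this, hz, hdet']; rfl⟩
        obtain ⟨v, hv⟩ := hval
        rw [hv]
        refine ⟨?_, fun _ h => by simp at h⟩
        rintro out ⟨⟩
        exact hs.isCert_of_dependent he hS hi (not_lt.1 hdet)

/-- Each move adds 1/n² to `θ`, so after at most `k` moves the norm is beyond the bound. One more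
step is needed to notice this and produce the output. -/
lemma iterate_bubbleStep_spec (hu : ∀ j, 0 < u j)
    (hS : IsSetup (fun j => u j * u j / 4) A b u S) :
    ∀ (k : ℕ) (s : BubbleState ℝ n), Invariant (fun j => u j * u j / 4) A S s →
      4 * n < S.ρ + s.θ + k / (n : ℝ) ^ 2 →
      ∃ out, (Cost.iterate (bubbleStep realMachine S) (k + 1) s).val = Sum.inr out ∧
        out.Correct A b u := by
  intro k
  induction k with
  | zero =>
    intro s hs hk
    obtain ⟨h₁, h₂⟩ := bubbleStep_spec hu hS hs
    rw [Cost.iterate, Cost.bind_val]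
    rcases hv : (bubbleStep realMachine S s).val with s' | out
    · obtain ⟨-, -, h₅⟩ := h₂ s' hv
      rw [Nat.cast_zero, zero_div, add_zero] at hk
      exact absurd h₅ (not_le.2 hk)
    · exact ⟨out, rfl, h₁ out hv⟩
  | succ k ih =>
    intro s hs hk
    obtain ⟨h₁, h₂⟩ := bubbleStep_spec hu hS hs
    rw [Cost.iterate, Cost.bind_val]
    rcases hv : (bubbleStep realMachine S s).val with s' | out
    · obtain ⟨h₃, h₄, -⟩ := h₂ s' hv
      refine ih s' h₃ (hk.trans_le ?_)
      rw [Nat.cast_succ, add_div]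
      linarith
    · exact ⟨out, rfl, h₁ out hv⟩

/-- The selected value plays two roles: it is the first `θ`, and it dominates the squared distances
of all violated hyperplanes, which is the field `le` of `Invariant`. -/
lemma farthest_spec : ∀ {l : List (Fin n)} {best : Fin n × ℝ},
    0 < S.c best.1 → best.2 = S.c best.1 * S.c best.1 / S.g best.1 best.1 →
    let res := (farthest realMachine S l best).val
    0 < S.c res.1 ∧ res.2 = S.c res.1 * S.c res.1 / S.g res.1 res.1 ∧ best.2 ≤ res.2 ∧
      ∀ j ∈ l, 0 < S.c j → S.c j * S.c j / S.g j j ≤ res.2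
  | [], best, h₁, h₂ => ⟨h₁, h₂, le_rfl, by simp⟩
  | j :: l, best, h₁, h₂ => by
    simp only [farthest, Cost.bind_val, Cost.ite_val, realMachine_lt, realMachine_const,
      Nat.cast_zero, sqDist, realMachine_mul, realMachine_div]
    split_ifs with hc hd
    · obtain ⟨a₁, a₂, a₃, a₄⟩ :=
        farthest_spec (l := l) (best := (j, S.c j * S.c j / S.g j j)) hc rfl
      exact ⟨a₁, a₂, hd.le.trans a₃, List.forall_mem_cons.2 ⟨fun _ => a₃, a₄⟩⟩
    · obtain ⟨a₁, a₂, a₃, a₄⟩ := farthest_spec (l := l) h₁ h₂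
      exact ⟨a₁, a₂, a₃, List.forall_mem_cons.2 ⟨fun _ => (not_lt.1 hd).trans a₃, a₄⟩⟩
    · obtain ⟨a₁, a₂, a₃, a₄⟩ := farthest_spec (l := l) h₁ h₂
      exact ⟨a₁, a₂, a₃, List.forall_mem_cons.2 ⟨fun h => absurd h hc, a₄⟩⟩

/-- For `w = 0` the certified inequality is `0 < 0`, so the certificate says that the box contains
no feasible point. -/
lemma isCert_zero_of_forall (h : ∀ x, Solves A b x → (∀ j, 0 ≤ x j) → ¬ ∀ j, x j ≤ u j) :
    IsCert A b u 0 :=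
  ⟨fun _ => le_rfl, fun x hx h0 hxu => absurd hxu (h x hx h0)⟩

theorem bubble_spec (hu : ∀ j, 0 < u j) : (bubble realMachine A b u).val.Correct A b u := by
  set e : Fin n → ℝ := fun j => u j * u j / 4 with he_def
  have he : ∀ j, 0 < e j := fun j => by have := hu j; simp only [he_def]; positivity
  simp only [bubble, Cost.bind_val, invD_val]
  rcases hE : (eliminate realMachine e A b (List.finRange m) []).val with B | v
  swap
  · simp only [Cost.bind_val, Cost.pure_val, zeroVec_val]
    exact isCert_zero_of_forall fun x hx => absurd ⟨x, hx⟩ (unsolvable_of_eliminate he hE)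
  have hS : IsSetup e A b u (setup realMachine A b u e B).val :=
    (isEliminated_of_eliminate he hE).isSetup he
  simp only [Cost.bind_val, ← he_def]
  set S := (setup realMachine A b u e B).val with hS_def
  rw [Cost.ite_val]
  split_ifs with hρ
  · simp only [realMachine_lt, realMachine_const] at hρ
    push_cast at hρ
    simp only [Cost.bind_val, Cost.pure_val, zeroVec_val]
    refine isCert_zero_of_forall fun x hx h0 hxu => ?_
    have h₁ := two_mul_dInner_le he S.r x
    have h₂ := dInner_self_le_of_le hu h0 hxu
    have h₃ := hS.perp _ (hx.sub hS.solves)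
    rw [dInner_sub_right] at h₃
    have h₄ := hS.ρ_eq
    linarith
  rw [Cost.bind_val]
  rcases hf : (findNeg realMachine S.r).val with _ | i
  · exact ⟨hS.solves, findNeg_none hf⟩
  simp only [Cost.bind_val, realMachine_const, Nat.cast_zero]
  have hn : (0 : ℝ) < n := by exact_mod_cast i.pos
  have hg0 : ∀ j, S.g j j = dInner e (S.g j) (S.g j) := fun j =>
    (hS.dInner_g j (hS.represents j).ker).symm
  split
  · rename_i j hj
    have hj := (Cost.find_val_some hj).2
    simp only [Cost.bind_val, Cost.pure_val, Bool.and_eq_true, realMachine_lt, Bool.not_eq_true',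
      realMachine_lt_eq_false] at hj
    simp only [Cost.bind_val, Cost.pure_val, unitVec_val]
    refine hS.isCert_of_zero (fun k => ?_) (fun x hx => ?_) ?_
    · rw [Pi.single_apply]; split_ifs <;> norm_num
    · rw [← (hS.represents j).dual x hx,
        eq_zero_of_dInner_self_nonpos he ((hg0 j).symm.trans_le hj.2)]
      simp [dInner]
    · simpa [Pi.single_apply] using hj.1
  rename_i hempty
  have hpos : ∀ j, 0 < S.c j → 0 < S.g j j := fun j hj => by
    have := Cost.find_val_none hempty (List.mem_finRange j)
    simp only [Cost.bind_val, Cost.pure_val, Bool.and_eq_false_iff, realMachine_lt_eq_false,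
      Bool.not_eq_false', realMachine_lt] at this
    exact this.resolve_left (not_le.2 hj)
  have hci : 0 < S.c i := by
    have h1 := findNeg_some hf
    have h2 := hu i
    have h3 : 0 < u i / (2 * n) := by positivity
    rw [hS.c_eq]
    linarith
  obtain ⟨h₁, h₂, -, h₄⟩ := farthest_spec (S := S) (l := List.finRange n)
    (best := (i, (sqDist realMachine S i).val)) hci (by simp [sqDist])
  simp only [Cost.bind_val]
  set best := (farthest realMachine S (List.finRange n) (i, (sqDist realMachine S i).val)).val
    with hbest
  have hgb := hpos _ h₁
  have hinv : Invariant e A S ⟨(S.c best.1 / S.g best.1 best.1) • Pi.single best.1 1,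
      (S.c best.1 / S.g best.1 best.1) • S.g best.1, best.2⟩ := by
    refine ⟨fun j => ?_, (hS.represents _).smul _, ?_, ?_, ?_, fun j hj => ?_⟩
    · have h1 : (0 : ℝ) ≤ Pi.single (M := fun _ => ℝ) best.1 1 j := by
        rw [Pi.single_apply]; split_ifs <;> norm_num
      simp only [Pi.smul_apply, smul_eq_mul]
      positivity
    · simp only [dInner_smul_left, dInner_smul_right, ← hg0, h₂]
      field_simp
    · simp only [Pi.smul_apply, smul_eq_mul, mul_assoc, ← Finset.mul_sum, h₂]
      simp [Pi.single_apply]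
      ring
    · simp only [h₂]
      positivity
    · have := h₄ j (List.mem_finRange j) hj
      rw [div_le_iff₀ (hpos j hj)] at this
      simp only
      linarith
  have hρ0 : 0 ≤ S.ρ := hS.ρ_eq ▸ dInner_self_nonneg he _
  -- 4n³ gains of 1/n² make 4n, and the positive initial `θ` makes the inequality strict. Hence the
  -- loop always ends with an output and the fallback after it is never reached.
  have hfuel : (4 * n : ℝ) < S.ρ + best.2 + ((4 * n ^ 3 : ℕ) : ℝ) / (n : ℝ) ^ 2 := by
    have h1 : ((4 * n ^ 3 : ℕ) : ℝ) / (n : ℝ) ^ 2 = 4 * n := by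
      push_cast
      field_simp
    rw [h1]
    have := hinv.θ_pos
    simp only at this
    linarith
  obtain ⟨out, ho, hcorr⟩ := iterate_bubbleStep_spec hu hS (4 * n ^ 3) _ hinv hfuel
  simp only [realMachine_div, unitVec_val, smul_val, ho]
  exact hcorr

end Bubble

/-! ### The number `Δ` -/

section Columns

lemma insertDesc_perm (x : ℝ) : ∀ l : List ℝ, (insertDesc realMachine x l).val.Perm (x :: l)
  | [] => .refl _
  | y :: l => by
    simp only [insertDesc, Cost.bind_val, Cost.ite_val, Cost.pure_val]
    split_ifs
    · rfl
    · exact ((insertDesc_perm x l).cons y).trans (.swap x y l)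

lemma insertDesc_pairwise (x : ℝ) : ∀ {l : List ℝ}, l.Pairwise (· ≥ ·) →
    (insertDesc realMachine x l).val.Pairwise (· ≥ ·)
  | [], _ => by simp [insertDesc]
  | y :: l, h => by
    obtain ⟨h₁, h₂⟩ := List.pairwise_cons.1 h
    simp only [insertDesc, Cost.bind_val, Cost.ite_val, Cost.pure_val, realMachine_lt]
    split_ifs with hxy
    · exact List.pairwise_cons.2
        ⟨List.forall_mem_cons.2 ⟨hxy.le, fun a ha => (h₁ a ha).trans hxy.le⟩, h⟩
    · refine List.pairwise_cons.2 ⟨fun a ha => ?_, insertDesc_pairwise x h₂⟩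
      rcases List.mem_cons.1 ((insertDesc_perm x l).subset ha) with rfl | ha
      exacts [not_lt.1 hxy, h₁ a ha]

lemma sortDesc_perm : ∀ l : List ℝ, (sortDesc realMachine l).val.Perm l
  | [] => .refl _
  | x :: l => (insertDesc_perm x _).trans ((sortDesc_perm l).cons x)

lemma sortDesc_pairwise : ∀ l : List ℝ, (sortDesc realMachine l).val.Pairwise (· ≥ ·)
  | [] => .nil
  | x :: l => insertDesc_pairwise x (sortDesc_pairwise l)

lemma prod_val : ∀ l : List ℝ, (prod realMachine l).val = l.prod
  | [] => by simp [prod]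
  | x :: l => by simp [prod, prod_val l]

/-- The i-th entry of a sublist occurs in `l` at position i or later, so in a decreasing list it is
at most the i-th entry of `l`. -/
lemma prod_le_prod_take {l' l : List ℝ} (h : l'.Sublist l) (hl : l.Pairwise (· ≥ ·))
    (h0 : ∀ x ∈ l, 0 ≤ x) : l'.prod ≤ (l.take l'.length).prod := by
  induction l generalizing l' with
  | nil => simp [List.sublist_nil.1 h]
  | cons a l ih =>
    obtain ⟨ha, hl⟩ := List.pairwise_cons.1 hl
    obtain ⟨ha0, h0⟩ := List.forall_mem_cons.1 h0
    rcases l' with _ | ⟨b, l'⟩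
    · simp
    · have hsub : l'.Sublist l := by
        cases h with
        | cons _ h => exact (List.sublist_cons_self _ _).trans h
        | cons_cons _ h => exact h
      have hb : b ≤ a := by
        rcases List.mem_cons.1 (h.subset List.mem_cons_self) with rfl | hb
        exacts [le_rfl, ha b hb]
      rw [List.prod_cons, List.length_cons, List.take_succ_cons, List.prod_cons]
      exact mul_le_mul hb (ih hsub hl h0)
        (List.prod_nonneg fun x hx => h0 x (hsub.subset hx)) ha0

lemma one_le_prod_map_max : ∀ l : List ℝ, 1 ≤ (l.map (max 1)).prod
  | [] => le_rfl
  | x :: l => by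
    rw [List.map_cons, List.prod_cons]
    exact one_le_mul_of_one_le_of_one_le (le_max_left _ _) (one_le_prod_map_max l)

/-- With all factors raised to at least 1, including the omitted ones does no harm. The bound for
`Δ` then need not know which columns are largest. -/
lemma prod_take_le_prod_map_max : ∀ (l : List ℝ) (k : ℕ), (∀ x ∈ l, 0 ≤ x) →
    (l.take k).prod ≤ (l.map (max 1)).prod
  | l, 0, _ => by simpa using one_le_prod_map_max l
  | [], k + 1, _ => by simp
  | x :: l, k + 1, h => by
    obtain ⟨hx, h⟩ := List.forall_mem_cons.1 h
    rw [List.take_succ_cons, List.prod_cons, List.map_cons, List.prod_cons]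
    exact mul_le_mul (le_max_right _ _) (prod_take_le_prod_map_max l k h)
      (List.prod_nonneg fun y hy => h y (List.mem_of_mem_take hy)) (zero_le_one.trans (le_max_left _ _))

/-- The columns of `(A, b)`, beginning with `b`. -/
def column {m n : ℕ} (A : Matrix (Fin m) (Fin n) ℤ) (b : Fin m → ℤ) :
    Fin (n + 1) → Fin m → ℤ :=
  Fin.cons b fun j i => A i j

/-- The squares of the Euclidean norms of the columns of `(A, b)`. -/
def columnSq {m n : ℕ} (A : Matrix (Fin m) (Fin n) ℤ) (b : Fin m → ℤ) (k : Fin (n + 1)) : ℝ :=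
  ∑ i, (column A b k i : ℝ) ^ 2

variable {m n : ℕ} (A : Matrix (Fin m) (Fin n) ℤ) (b : Fin m → ℤ)

/-- The value of `Δ`. -/
noncomputable def Delta : ℝ :=
  (delta realMachine (fun i j => (A i j : ℝ)) (fun i => (b i : ℝ))).val

lemma columnSq_nonneg (k : Fin (n + 1)) : 0 ≤ columnSq A b k :=
  Finset.sum_nonneg fun _ _ => sq_nonneg _

lemma Delta_nonneg : 0 ≤ Delta A b := Real.sqrt_nonneg _

lemma mem_sortDesc_ofFn {x : ℝ}
    (h : x ∈ (sortDesc realMachine (List.ofFn (columnSq A b))).val) : ∃ k, columnSq A b k = x :=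
  List.mem_ofFn.1 ((sortDesc_perm _).subset h)

lemma Delta_sq : Delta A b ^ 2 =
    ((sortDesc realMachine (List.ofFn (columnSq A b))).val.take m).prod := by
  have hl : (List.ofFn (columnSq A b)) = (dot realMachine (fun i => (b i : ℝ)) fun i => (b i : ℝ)).val
      :: List.ofFn fun j => (dot realMachine (fun i => (A i j : ℝ)) fun i => (A i j : ℝ)).val := by
    rw [List.ofFn_succ]
    simp [columnSq, column, sq]
  rw [hl]
  simp only [Delta, delta, Cost.bind_val, prod_val, realMachine_sqrt, Cost.vec_val]
  rw [Real.sq_sqrt]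
  refine List.prod_nonneg fun x hx => ?_
  rw [← hl] at hx
  obtain ⟨k, rfl⟩ := mem_sortDesc_ofFn A b (List.mem_of_mem_take hx)
  exact columnSq_nonneg A b k

lemma prod_columnSq_le_Delta_sq {f : Fin m → Fin (n + 1)} (hf : Function.Injective f) :
    ∏ i, columnSq A b (f i) ≤ Delta A b ^ 2 := by
  set L := (sortDesc realMachine (List.ofFn (columnSq A b))).val with hL
  have hsub : (List.ofFn fun i => columnSq A b (f i)).Subperm L := by
    refine List.Subperm.trans ?_ (sortDesc_perm _).symm.subperm
    rw [List.ofFn_eq_map, List.ofFn_eq_map, ← Function.comp_def (columnSq A b) f, ← List.map_map]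
    obtain ⟨l, hl, hsub⟩ :=
      ((List.nodup_finRange m).map hf).subperm fun k _ => List.mem_finRange k
    exact ⟨l.map _, hl.map _, hsub.map _⟩
  obtain ⟨l, hl, hlL⟩ := hsub
  have h := prod_le_prod_take hlL (sortDesc_pairwise _) fun x hx => by
    obtain ⟨k, rfl⟩ := mem_sortDesc_ofFn A b hx
    exact columnSq_nonneg A b k
  rw [hl.prod_eq, hl.length_eq, List.length_ofFn, List.prod_ofFn] at h
  rwa [Delta_sq]

lemma exists_intCast_eq_prod : ∀ {l : List ℝ}, (∀ x ∈ l, ∃ z : ℤ, x = z) → ∃ z : ℤ, l.prod = z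
  | [], _ => ⟨1, by simp⟩
  | x :: l, h => by
    obtain ⟨⟨z, hz⟩, h⟩ := List.forall_mem_cons.1 h
    obtain ⟨y, hy⟩ := exists_intCast_eq_prod h
    exact ⟨z * y, by rw [List.prod_cons, hz, hy, Int.cast_mul]⟩

/-- Used with rounding: it makes the initial bound `Δ` a multiple of 1/(3nΔ). -/
lemma exists_intCast_eq_Delta_sq : ∃ z : ℤ, Delta A b ^ 2 = z := by
  rw [Delta_sq]
  refine exists_intCast_eq_prod fun x hx => ?_
  obtain ⟨k, rfl⟩ := mem_sortDesc_ofFn A b (List.mem_of_mem_take hx)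
  exact ⟨∑ i, column A b k i ^ 2, by simp [columnSq]⟩

lemma log_one_add_natAbs_le (a : ℤ) : Real.log (1 + |(a : ℝ)|) ≤ intSize a := by
  have h : 1 + |(a : ℝ)| ≤ 2 ^ Nat.clog 2 (a.natAbs + 1) := by
    have := Nat.le_pow_clog one_lt_two (a.natAbs + 1)
    have h' : (((a.natAbs + 1 : ℕ)) : ℝ) ≤ ((2 ^ Nat.clog 2 (a.natAbs + 1) : ℕ) : ℝ) :=
      Nat.cast_le.2 this
    push_cast at h'
    rw [Nat.cast_natAbs, Int.cast_abs] at h'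
    linarith
  calc Real.log (1 + |(a : ℝ)|) ≤ Real.log (2 ^ Nat.clog 2 (a.natAbs + 1)) :=
        Real.log_le_log (by positivity) h
    _ = Nat.clog 2 (a.natAbs + 1) * Real.log 2 := Real.log_pow _ _
    _ ≤ Nat.clog 2 (a.natAbs + 1) * 1 := by
        gcongr
        linarith [Real.log_two_lt_d9]
    _ ≤ intSize a := by
        simp [intSize]

lemma one_le_prod_one_add (v : Fin m → ℤ) : ∀ s : Finset (Fin m), 1 ≤ ∏ i ∈ s, (1 + |(v i : ℝ)|) :=
  fun _ => Finset.prod_induction _ (1 ≤ ·) (fun _ _ => one_le_mul_of_one_le_of_one_le) le_rfl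
    fun _ _ => le_add_of_nonneg_right (abs_nonneg _)

lemma sum_sq_le_prod_sq (v : Fin m → ℤ) (s : Finset (Fin m)) :
    max 1 (∑ i ∈ s, (v i : ℝ) ^ 2) ≤ (∏ i ∈ s, (1 + |(v i : ℝ)|)) ^ 2 := by
  refine max_le (one_le_pow₀ (one_le_prod_one_add v s)) ?_
  induction s using Finset.induction_on with
  | empty => simp
  | insert i s hi ih =>
    rw [Finset.sum_insert hi, Finset.prod_insert hi, mul_pow]
    have h1 := one_le_pow₀ (one_le_prod_one_add v s) (n := 2)
    have h2 : (v i : ℝ) ^ 2 + 1 ≤ (1 + |(v i : ℝ)|) ^ 2 := by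
      nlinarith [abs_nonneg (v i : ℝ), sq_abs (v i : ℝ)]
    nlinarith [sq_nonneg (v i : ℝ)]

/-- The norm of each column is at most the product of 1 + |a| over its entries, and log(1 + |a|) is
at most the encoding length of a. -/
lemma log_Delta_le (h1 : 1 ≤ Delta A b) : Real.log (Delta A b) ≤ encodingSize A b := by
  set L := (sortDesc realMachine (List.ofFn (columnSq A b))).val with hL
  have h2 : Delta A b ^ 2 ≤ (∏ k, ∏ i, (1 + |(column A b k i : ℝ)|)) ^ 2 := by
    rw [Delta_sq]
    calc (L.take m).prod ≤ (L.map (max 1)).prod := prod_take_le_prod_map_max _ _ fun x hx => by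
          obtain ⟨k, rfl⟩ := mem_sortDesc_ofFn A b hx
          exact columnSq_nonneg A b k
      _ = ∏ k, max 1 (columnSq A b k) := by
          rw [((sortDesc_perm _).map _).prod_eq, List.map_ofFn, List.prod_ofFn]
          rfl
      _ ≤ ∏ k, (∏ i, (1 + |(column A b k i : ℝ)|)) ^ 2 :=
          Finset.prod_le_prod (fun _ _ => zero_le_one.trans (le_max_left _ _))
            fun k _ => sum_sq_le_prod_sq _ _
      _ = _ := Finset.prod_pow _ _ _
  have h3 : Delta A b ≤ ∏ k, ∏ i, (1 + |(column A b k i : ℝ)|) :=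
    le_of_sq_le_sq h2 (by positivity)
  refine (Real.log_le_log (by linarith) h3).trans ?_
  rw [Real.log_prod fun k _ => by positivity]
  calc ∑ k, Real.log (∏ i, (1 + |(column A b k i : ℝ)|))
      = ∑ k, ∑ i, Real.log (1 + |(column A b k i : ℝ)|) :=
        Finset.sum_congr rfl fun k _ => Real.log_prod fun i _ => by positivity
    _ ≤ ∑ k, ∑ i, (intSize (column A b k i) : ℝ) :=
        Finset.sum_le_sum fun k _ => Finset.sum_le_sum fun i _ => log_one_add_natAbs_le _
    _ = encodingSize A b := by
        rw [Fin.sum_univ_succ]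
        simp only [column, Fin.cons_zero, Fin.cons_succ, encodingSize, Nat.cast_add, Nat.cast_sum]
        rw [add_comm, Finset.sum_comm]

end Columns

/-! ### Basic solutions -/

section Basic

/-- Hadamard's inequality, read off from the bound for the volume form of Euclidean space. -/
lemma det_sq_le_prod {m : ℕ} (M : Matrix (Fin m) (Fin m) ℝ) :
    M.det ^ 2 ≤ ∏ j, ∑ i, M i j ^ 2 := by
  have : Fact (Module.finrank ℝ (EuclideanSpace ℝ (Fin m)) = m) := ⟨finrank_euclideanSpace_fin⟩
  set B := EuclideanSpace.basisFun (Fin m) ℝ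
  set v : Fin m → EuclideanSpace ℝ (Fin m) := fun j => WithLp.toLp 2 fun i => M i j
  have h := B.toBasis.orientation.abs_volumeForm_apply_le v
  rw [Orientation.volumeForm_robust _ B rfl, Module.Basis.det_apply] at h
  have hM : B.toBasis.toMatrix v = M := by
    ext i j
    simp [Module.Basis.toMatrix_apply, B, v]
  rw [hM] at h
  calc M.det ^ 2 = |M.det| ^ 2 := (sq_abs _).symm
    _ ≤ (∏ j, ‖v j‖) ^ 2 := pow_le_pow_left₀ (abs_nonneg _) h 2
    _ = ∏ j, ∑ i, M i j ^ 2 := by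
      rw [← Finset.prod_pow]
      refine Finset.prod_congr rfl fun j _ => ?_
      rw [EuclideanSpace.norm_sq_eq]
      simp [v]

lemma abs_det_le_Delta {m n : ℕ} (A : Matrix (Fin m) (Fin n) ℤ) (b : Fin m → ℤ)
    {f : Fin m → Fin (n + 1)} (hf : Function.Injective f) (M : Matrix (Fin m) (Fin m) ℤ)
    (hM : ∀ i k, M i k = column A b (f k) i) : |(M.det : ℝ)| ≤ Delta A b := by
  refine abs_le_of_sq_le_sq ?_ (Delta_nonneg A b)
  have h := det_sq_le_prod (M.map (Int.cast : ℤ → ℝ))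
  have hd : (M.map (Int.cast : ℤ → ℝ)).det = M.det := ((Int.castRingHom ℝ).map_det M).symm
  rw [hd] at h
  refine h.trans (le_trans (le_of_eq ?_) (prod_columnSq_le_Delta_sq A b hf))
  simp [columnSq, hM]

/-- A solution with linearly independent support. -/
lemma exists_linearIndepOn_support {m n : ℕ} (A : Matrix (Fin m) (Fin n) ℝ) {b : Fin m → ℝ}
    (h : ∃ x, A.mulVec x = b ∧ ∀ j, 0 ≤ x j) :
    ∃ x, (A.mulVec x = b ∧ ∀ j, 0 ≤ x j) ∧ LinearIndepOn ℝ A.col {j | x j ≠ 0} := by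
  classical
  -- Among the feasible points one of minimal support is taken. A dependency between its columns
  -- would allow a move that shrinks the support.
  obtain ⟨x, ⟨hx, hx0⟩, hmin⟩ := exists_minimalFor_of_wellFoundedLT
    (fun x : Fin n → ℝ => A.mulVec x = b ∧ ∀ j, 0 ≤ x j)
    (fun x => (Finset.univ.filter fun j => x j ≠ 0).card) h
  refine ⟨x, ⟨hx, hx0⟩, ?_⟩
  by_contra hdep
  have hset : {j | x j ≠ 0} = ((Finset.univ.filter fun j => x j ≠ 0 : Finset (Fin n)) : Set (Fin n)) := by
    ext; simp
  rw [hset, linearIndepOn_finset_iff] at hdep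
  push Not at hdep
  obtain ⟨g, hg, i, hi, hgi⟩ := hdep
  obtain ⟨y, hyx, hy, k, hk⟩ : ∃ y : Fin n → ℝ, (∀ j, x j = 0 → y j = 0) ∧ A.mulVec y = 0 ∧
      ∃ k, 0 < y k := by
    set y₀ : Fin n → ℝ := fun j => if x j ≠ 0 then g j else 0 with hy₀
    have h₀ : A.mulVec y₀ = 0 := by
      rw [Finset.sum_filter] at hg
      rw [Matrix.mulVec_eq_sum, ← hg]
      refine Finset.sum_congr rfl fun j _ => ?_
      simp only [hy₀, op_smul_eq_smul]
      split_ifs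
      · rfl
      · exact zero_smul _ _
    have hi' : x i ≠ 0 := by simpa using hi
    have hyi : y₀ i = g i := if_pos hi'
    -- The sign is chosen so that the direction has a positive entry, which is then driven towards
    -- 0.
    rcases lt_or_gt_of_ne hgi with hneg | hpos
    · refine ⟨-y₀, fun j hj => by simp [hy₀, hj], by rw [Matrix.mulVec_neg, h₀, neg_zero], i, ?_⟩
      rw [Pi.neg_apply, hyi]; linarith
    · exact ⟨y₀, fun j hj => by simp [hy₀, hj], h₀, i, by rwa [hyi]⟩
  -- The ratio test: the largest step that keeps the point nonnegative, at which coordinate `l`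
  -- vanishes.
  obtain ⟨l, hl, hlmin⟩ := Finset.exists_min_image (Finset.univ.filter fun j => 0 < y j)
    (fun j => x j / y j) ⟨k, by simpa using hk⟩
  have hyl : 0 < y l := by simpa using hl
  set t := x l / y l with ht
  have ht0 : 0 ≤ t := div_nonneg (hx0 l) hyl.le
  have hxl : x l ≠ 0 := fun h => hyl.ne' (hyx l h)
  have hfeas : A.mulVec (x - t • y) = b ∧ ∀ j, 0 ≤ (x - t • y) j := by
    refine ⟨by rw [Matrix.mulVec_sub, Matrix.mulVec_smul, hy, hx, smul_zero, sub_zero], fun j => ?_⟩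
    simp only [Pi.sub_apply, Pi.smul_apply, smul_eq_mul, sub_nonneg]
    rcases le_or_gt (y j) 0 with hj | hj
    · exact (mul_nonpos_of_nonneg_of_nonpos ht0 hj).trans (hx0 j)
    · exact (le_div_iff₀ hj).1 (hlmin j (by simpa using hj))
  have hlt : (Finset.univ.filter fun j => (x - t • y) j ≠ 0).card <
      (Finset.univ.filter fun j => x j ≠ 0).card := by
    refine Finset.card_lt_card (Finset.ssubset_iff_subset_ne.2 ⟨fun j => ?_, fun h => ?_⟩)
    · simp only [Finset.mem_filter, Finset.mem_univ, true_and, Pi.sub_apply, Pi.smul_apply,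
        smul_eq_mul]
      intro h h'
      exact h (by rw [h', hyx j h']; ring)
    · have : l ∈ Finset.univ.filter fun j => x j ≠ 0 := by simpa using hxl
      rw [← h] at this
      simp [ht, hyl.ne'] at this
  exact absurd (hmin hfeas hlt.le) (not_le.2 hlt)

variable {m n : ℕ} {A : Matrix (Fin m) (Fin n) ℤ}

/-- Linearly independent columns can be extended to a nonsingular square submatrix. -/
lemma exists_det_ne_zero (hA : (A.map (Int.cast : ℤ → ℝ)).rank = m) {s : Set (Fin n)}
    (hs : LinearIndepOn ℝ (A.map (Int.cast : ℤ → ℝ)).col s) :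
    ∃ f : Fin m → Fin n, Function.Injective f ∧ s ⊆ Set.range f ∧
      (A.submatrix id f).det ≠ 0 := by
  classical
  set A' := A.map (Int.cast : ℤ → ℝ) with hA'
  obtain ⟨t, -, hst, hspan, hli⟩ := exists_linearIndepOn_extension hs (Set.subset_univ s)
  have htop : (⊤ : Submodule ℝ (Fin m → ℝ)) ≤ Submodule.span ℝ (Set.range fun j : t => A'.col j) := by
    have h1 : Submodule.span ℝ (Set.range A'.col) = ⊤ := by
      refine Submodule.eq_top_of_finrank_eq ?_
      rw [← Matrix.rank_eq_finrank_span_cols, hA]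
      simp
    rw [← h1, Submodule.span_le, ← Set.image_univ]
    refine hspan.trans ?_
    rw [Set.image_eq_range]
  have hcard : Fintype.card t = m := by
    rw [← Module.finrank_eq_card_basis (Module.Basis.mk hli htop)]
    simp
  let σ := (Fintype.equivFinOfCardEq hcard).symm
  refine ⟨fun k => σ k, Subtype.val_injective.comp σ.injective, fun j hj => ?_, ?_⟩
  · obtain ⟨k, hk⟩ := σ.surjective ⟨j, hst hj⟩
    exact ⟨k, by simp [hk]⟩
  · have h2 : LinearIndependent ℝ (A'.submatrix id fun k => (σ k : Fin n)).col :=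
      hli.comp σ σ.injective
    rw [Matrix.linearIndependent_cols_iff_isUnit, Matrix.isUnit_iff_isUnit_det] at h2
    intro h0
    have h3 : (A'.submatrix id fun k => (σ k : Fin n)).det =
        ((A.submatrix id fun k => (σ k : Fin n)).det : ℝ) :=
      ((Int.castRingHom ℝ).map_det (A.submatrix id fun k => (σ k : Fin n))).symm
    rw [h3, h0] at h2
    simp at h2

lemma one_le_Delta (hA : (A.map (Int.cast : ℤ → ℝ)).rank = m) (b : Fin m → ℤ) : 1 ≤ Delta A b := by
  obtain ⟨f, hf, -, hdet⟩ := exists_det_ne_zero hA (linearIndepOn_empty ℝ _)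
  have h1 : (1 : ℝ) ≤ |((A.submatrix id f).det : ℝ)| := by exact_mod_cast Int.one_le_abs hdet
  exact h1.trans (abs_det_le_Delta A b (f := fun k => (f k).succ) ((Fin.succ_injective n).comp hf) _
    fun i k => by simp [column])

/-- A feasible system has a solution whose nonzero entries lie between `1 / Δ` and `Δ`. -/
theorem exists_bounded_solution (hA : (A.map (Int.cast : ℤ → ℝ)).rank = m) (b : Fin m → ℤ)
    (h : ∃ x : Fin n → ℝ,
      (A.map (Int.cast : ℤ → ℝ)).mulVec x = (fun i => (b i : ℝ)) ∧ ∀ j, 0 ≤ x j) :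
    ∃ x : Fin n → ℝ, ((A.map (Int.cast : ℤ → ℝ)).mulVec x = (fun i => (b i : ℝ)) ∧
      ∀ j, 0 ≤ x j) ∧ ∀ j, x j ≤ Delta A b ∧ (x j ≠ 0 → 1 / Delta A b ≤ x j) := by
  classical
  obtain ⟨x, ⟨hx, hx0⟩, hli⟩ := exists_linearIndepOn_support _ h
  refine ⟨x, ⟨hx, hx0⟩, fun j => ?_⟩
  have hDelta := one_le_Delta hA b
  obtain ⟨f, hf, hsub, hdet⟩ := exists_det_ne_zero hA hli
  set M := A.submatrix id f with hM
  set M' := M.map (Int.cast : ℤ → ℝ) with hM'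
  by_cases hj : x j = 0
  · exact ⟨by rw [hj]; linarith, fun h => absurd hj h⟩
  obtain ⟨k, rfl⟩ := hsub hj
  have hMx : M'.mulVec (fun k => x (f k)) = fun i => (b i : ℝ) := by
    rw [← hx]
    ext i
    change ∑ k, A.map (Int.cast : ℤ → ℝ) i (f k) * x (f k) = ∑ j, A.map (Int.cast : ℤ → ℝ) i j * x j
    rw [← Finset.sum_image (f := fun j => A.map (Int.cast : ℤ → ℝ) i j * x j) (g := f)
      (fun a _ b _ h => hf h)]
    refine Finset.sum_subset (Finset.subset_univ _) fun j _ hj => ?_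
    have : x j = 0 := by
      by_contra h0
      obtain ⟨k, rfl⟩ := hsub h0
      exact hj (Finset.mem_image_of_mem _ (Finset.mem_univ k))
    rw [this, mul_zero]
  -- Cramer's rule. Both determinants are nonzero integers, so their absolute values lie in [1, Δ]
  -- and their quotient in [1/Δ, Δ].
  have hcr : M'.det * x (f k) = ((M.updateCol k b).det : ℝ) := by
    have h1 : M'.adjugate.mulVec (M'.mulVec fun k => x (f k)) k = M'.det * x (f k) := by
      rw [Matrix.mulVec_mulVec, Matrix.adjugate_mul, Matrix.smul_mulVec, Matrix.one_mulVec]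
      rfl
    rw [← h1, hMx, ← Matrix.cramer_eq_adjugate_mulVec, Matrix.cramer_apply]
    have h2 : M'.updateCol k (fun i => (b i : ℝ)) = (M.updateCol k b).map (Int.cast : ℤ → ℝ) := by
      ext i l
      simp only [Matrix.updateCol_apply, Matrix.map_apply, hM']
      split_ifs <;> rfl
    rw [h2]
    exact ((Int.castRingHom ℝ).map_det _).symm
  have hd : M'.det = M.det := ((Int.castRingHom ℝ).map_det M).symm
  have hdet1 : (1 : ℝ) ≤ |(M.det : ℝ)| := by exact_mod_cast Int.one_le_abs hdet
  have hdetDelta : |(M.det : ℝ)| ≤ Delta A b := by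
    refine abs_det_le_Delta A b (f := fun k => (f k).succ) ((Fin.succ_injective n).comp hf) _
      fun i k => ?_
    simp [column, hM]
  have hdetk : |((M.updateCol k b).det : ℝ)| ≤ Delta A b := by
    -- Index 0 of `column` is `b`, so putting `b` in place of column `k` still selects distinct
    -- columns of (A, b).
    refine abs_det_le_Delta A b (f := fun l => if l = k then 0 else (f l).succ) (fun l l' h => ?_) _
      fun i l => ?_
    · by_cases h1 : l = k <;> by_cases h2 : l' = k
      · rw [h1, h2]
      · simp only [h1, h2, if_true, if_false] at h
        exact absurd h.symm (Fin.succ_ne_zero _)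
      · simp only [h1, h2, if_true, if_false] at h
        exact absurd h (Fin.succ_ne_zero _)
      · simp only [h1, h2, if_false] at h
        exact hf (Fin.succ_injective n h)
    · by_cases hl : l = k <;> simp [column, hl, hM]
  rw [hd] at hcr
  have hxk : 0 < x (f k) := lt_of_le_of_ne (hx0 _) (Ne.symm hj)
  have habs : |(M.det : ℝ)| * x (f k) = |((M.updateCol k b).det : ℝ)| := by
    rw [← hcr, abs_mul, abs_of_pos hxk]
  have hk1 : (1 : ℝ) ≤ |((M.updateCol k b).det : ℝ)| := by
    have : (M.updateCol k b).det ≠ 0 := fun h0 => by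
      rw [h0, Int.cast_zero, abs_zero] at habs
      have : 0 < |(M.det : ℝ)| * x (f k) := by positivity
      linarith
    exact_mod_cast Int.one_le_abs this
  refine ⟨by nlinarith, fun _ => ?_⟩
  rw [div_le_iff₀ (by linarith)]
  nlinarith

end Basic

/-! ### One iteration of the full algorithm -/

/-! ### Uniqueness of the solution of the restricted equations -/

section Unique

variable {m n : ℕ} {e : Fin n → ℝ} {A : Fin m → Fin n → ℝ} {b : Fin m → ℝ}
  {B : List (Equation ℝ m n)}

lemma weighted_sum_smul {ι : Type*} [Fintype ι] (e f : Fin n → ℝ) (c : ι → ℝ)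
    (v : ι → Fin n → ℝ) : weighted e f (∑ k, c k • v k) = ∑ k, c k * weighted e f (v k) := by
  simp only [weighted, Finset.sum_apply, Pi.smul_apply, smul_eq_mul, Finset.mul_sum]
  rw [Finset.sum_comm]
  exact Finset.sum_congr rfl fun _ _ => Finset.sum_congr rfl fun _ _ => by ring

lemma IsOrthogonal.linearIndependent (hB : IsOrthogonal e A b B) :
    LinearIndependent ℝ fun k : Fin B.length => (B.get k).row := by
  rw [Fintype.linearIndependent_iff]
  intro c hc l
  have h := weighted_sum_smul e (B.get l).row c fun k => (B.get k).row
  have hlt := List.pairwise_iff_get.1 hB.orthogonal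
  rw [hc, Finset.sum_eq_single l (fun k _ hk => ?_) (by simp),
    ← hB.nrm _ (List.get_mem _ _)] at h
  · have h0 : weighted e (B.get l).row 0 = 0 := by simp [weighted]
    rw [h0] at h
    exact (mul_eq_zero.1 h.symm).resolve_right (hB.pos _ (List.get_mem _ _)).ne'
  · rcases lt_or_gt_of_ne hk with hk | hk
    · rw [weighted_comm, hlt _ _ hk, mul_zero]
    · rw [hlt _ _ hk, mul_zero]

lemma IsOrthogonal.length_le (hB : IsOrthogonal e A b B) : B.length ≤ n := by
  simpa using hB.linearIndependent.fintype_card_le_finrank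

/-- A full set of independent rows spans the whole space, so a kernel vector is orthogonal to
itself. -/
lemma IsOrthogonal.eq_zero_of_ker (hB : IsOrthogonal e A b B) (hn : B.length = n)
    {x : Fin n → ℝ} (hx : Ker A x) : x = 0 := by
  have hspan := hB.linearIndependent.span_eq_top_of_card_eq_finrank' (by simpa using hn)
  have h : ∀ w ∈ Submodule.span ℝ (Set.range fun k : Fin B.length => (B.get k).row),
      ∑ j, w j * x j = 0 := fun w hw => by
    induction hw using Submodule.span_induction with
    | mem w hw =>
      obtain ⟨k, rfl⟩ := hw
      rw [(hB.isComb _ (List.get_mem _ _)).row_dot]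
      simp [hx _]
    | zero => simp
    | add w w' _ _ h h' => simp only [Pi.add_apply, add_mul, Finset.sum_add_distrib, h, h', add_zero]
    | smul c w _ h => simp only [Pi.smul_apply, smul_eq_mul, mul_assoc, ← Finset.mul_sum, h, mul_zero]
  have hself := h x (hspan ▸ Submodule.mem_top)
  ext j
  simpa using (Finset.sum_eq_zero_iff_of_nonneg fun j _ => mul_self_nonneg (x j)).1 hself j
    (Finset.mem_univ j)

end Unique

/-! ### Extension of points by zeros -/

section Extend

variable {m n k : ℕ} {idx : Fin k → Fin n}

lemma extend_apply (hidx : Function.Injective idx) (x : Fin k → ℝ) (j : Fin k) :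
    (extend realMachine idx x).val (idx j) = x j := by
  simp only [extend, Cost.vec_val]
  split
  · rename_i j' hj'
    have := List.find?_some hj'
    simp only [decide_eq_true_eq] at this
    rw [hidx this, Cost.pure_val]
  · rename_i h
    have := List.find?_eq_none.1 h j (List.mem_finRange j)
    simp at this

lemma extend_apply_of_forall_ne (x : Fin k → ℝ) {i : Fin n} (hi : ∀ j, idx j ≠ i) :
    (extend realMachine idx x).val i = 0 := by
  simp only [extend, Cost.vec_val]
  split
  · rename_i j' hj'
    have := List.find?_some hj'
    simp only [decide_eq_true_eq] at this
    exact absurd this (hi j')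
  · simp

lemma sum_mul_eq_sum_idx (hidx : Function.Injective idx) (a : Fin n → ℝ) {y : Fin n → ℝ}
    (hy : ∀ i, (∀ j, idx j ≠ i) → y i = 0) :
    ∑ i, a i * y i = ∑ j, a (idx j) * y (idx j) :=
  (Fintype.sum_of_injective idx hidx _ _
    (fun i hi => by rw [hy i fun j hj => hi ⟨j, hj⟩, mul_zero]) fun _ => rfl).symm

lemma solves_extend {A : Fin m → Fin n → ℝ} {b : Fin m → ℝ} (hidx : Function.Injective idx)
    {x : Fin k → ℝ} (hx : Solves (fun i j => A i (idx j)) b x) (h0 : ∀ j, 0 ≤ x j) :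
    Solves A b (extend realMachine idx x).val ∧ ∀ i, 0 ≤ (extend realMachine idx x).val i := by
  refine ⟨fun i => ?_, fun i => ?_⟩
  · rw [sum_mul_eq_sum_idx hidx _ fun i hi => extend_apply_of_forall_ne x hi, ← hx i]
    exact Finset.sum_congr rfl fun j _ => by rw [extend_apply hidx]
  · by_cases hi : ∀ j, idx j ≠ i
    · rw [extend_apply_of_forall_ne x hi]
    · push Not at hi
      obtain ⟨j, rfl⟩ := hi
      rw [extend_apply hidx]
      exact h0 j

end Extend

/-! ### Shrinking and rounding the bounds -/

section Shrink

lemma one_add_sum_le_prod_one_add {ι : Type*} (s : Finset ι) {f : ι → ℝ} (hf : ∀ i, 0 ≤ f i) :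
    1 + ∑ i ∈ s, f i ≤ ∏ i ∈ s, (1 + f i) := by
  classical
  induction s using Finset.induction_on with
  | empty => simp
  | insert i s hi ih =>
    rw [Finset.sum_insert hi, Finset.prod_insert hi]
    nlinarith [hf i, Finset.sum_nonneg fun j (_ : j ∈ s) => hf j]

variable {k : ℕ} {u w : Fin k → ℝ} {tot : ℝ}

lemma newBound_spec (hu : ∀ j, 0 < u j) (htot : 0 < tot) (j : Fin k) :
    let q := (newBound realMachine tot u w j).val
    0 < q ∧ q ≤ u j ∧ q * (2 * k * w j) ≤ tot ∧
      (q = u j ∨ 0 < w j ∧ q = tot / (2 * k * w j)) := by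
  have hk : (0 : ℝ) < k := by exact_mod_cast j.pos
  have huj := hu j
  simp only [newBound, Cost.bind_val, Cost.ite_val, Cost.pure_val, realMachine_lt,
    realMachine_const, Nat.cast_zero, Nat.cast_mul, Nat.cast_ofNat, realMachine_mul,
    realMachine_div]
  split_ifs with hw hlt
  · have hp : 0 < 2 * k * w j := by positivity
    exact ⟨by positivity, hlt.le, (div_mul_cancel₀ _ hp.ne').le, .inr ⟨hw, rfl⟩⟩
  · have hp : 0 < 2 * k * w j := by positivity
    exact ⟨huj, le_rfl, (le_div_iff₀ hp).1 (not_lt.1 hlt), .inl rfl⟩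
  · refine ⟨huj, le_rfl, le_trans ?_ htot.le, .inl rfl⟩
    have : 2 * k * w j ≤ 0 := mul_nonpos_of_nonneg_of_nonpos (by positivity) (not_lt.1 hw)
    exact mul_nonpos_of_nonneg_of_nonpos huj.le this

/-- The product of the bounds decreases by a factor of at least `k + 1`. -/
lemma log_succ_le_sum_log_div (hu : ∀ j, 0 < u j) (htot : 0 < tot)
    (ht : tot = ∑ j, u j * w j) :
    Real.log (k + 1) ≤ ∑ j, Real.log (u j / (newBound realMachine tot u w j).val) := by
  have hq := newBound_spec (w := w) hu htot
  have h1 : ∀ j, 1 ≤ u j / (newBound realMachine tot u w j).val := fun j =>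
    (one_le_div (hq j).1).2 (hq j).2.1
  rw [← Real.log_prod fun j _ => (zero_lt_one.trans_le (h1 j)).ne']
  refine Real.log_le_log (by positivity) ?_
  -- These lower bounds for the ratios sum to 2k. As each ratio is at least 1, their product is at
  -- least 1 + ∑ (ratio - 1) ≥ 1 + 2k - k.
  have h2 : ∀ j, 2 * k * (u j * w j / tot) ≤ u j / (newBound realMachine tot u w j).val := fun j => by
    obtain ⟨hq0, -, hle, -⟩ := hq j
    rw [le_div_iff₀ hq0, mul_div_assoc', div_mul_eq_mul_div, div_le_iff₀ htot]
    nlinarith [hu j]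
  have h3 := one_add_sum_le_prod_one_add Finset.univ
    (f := fun j => u j / (newBound realMachine tot u w j).val - 1) fun j => sub_nonneg.2 (h1 j)
  simp only [add_sub_cancel] at h3
  refine le_trans ?_ h3
  have h4 : ∑ j, 2 * k * (u j * w j / tot) = 2 * k := by
    rw [← Finset.mul_sum, ← Finset.sum_div, ← ht, div_self htot.ne', mul_one]
  have h5 := Finset.sum_le_sum fun j (_ : j ∈ Finset.univ) => h2 j
  rw [h4] at h5
  simp only [Finset.sum_sub_distrib, Finset.sum_const, Finset.card_univ, Fintype.card_fin,
    nsmul_eq_mul, mul_one]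
  linarith

/-- Rounding adds at most 1/(3nΔ), which is at most x/(3n) once 1/Δ ≤ x. The minimality clause is
applied to the old bound, itself a multiple, so that rounding never raises a bound above its former
value. -/
lemma roundUp_spec {n : ℕ} (hn : 0 < n) {Δ x : ℝ} (hΔ : 0 < Δ) :
    let q := (roundUp realMachine n Δ x).val
    x ≤ q ∧ (1 / Δ ≤ x → q ≤ x * (1 + 1 / (3 * n))) ∧ (∃ z : ℤ, q * (3 * n * Δ) = z) ∧
      ∀ y, x ≤ y → (∃ z : ℤ, y * (3 * n * Δ) = z) → q ≤ y := by
  have hn' : (0 : ℝ) < n := by exact_mod_cast hn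
  have hP : 0 < 3 * n * Δ := by positivity
  have hval : (roundUp realMachine n Δ x).val = ⌈x * (3 * n * Δ)⌉ / (3 * n * Δ) := by
    simp [roundUp]
  simp only [hval]
  refine ⟨(le_div_iff₀ hP).2 (Int.le_ceil _), fun hx => ?_, ⟨_, div_mul_cancel₀ _ hP.ne'⟩,
    fun y hxy ⟨z, hz⟩ => ?_⟩
  · rw [div_le_iff₀ hP]
    refine (Int.ceil_lt_add_one _).le.trans ?_
    have h1 : 1 ≤ x * Δ := (div_le_iff₀ hΔ).1 hx
    have h2 : x * (1 + 1 / (3 * n)) * (3 * n * Δ) = x * (3 * n * Δ) + x * Δ := by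
      field_simp
    rw [h2]
    linarith
  · rw [div_le_iff₀ hP, hz]
    exact_mod_cast Int.ceil_le.2 ((mul_le_mul_of_nonneg_right hxy hP.le).trans hz.le)

end Shrink

/-! ### Potential, invariant and progress of one iteration -/

section Step

variable {m n : ℕ} {A : Fin m → Fin n → ℝ} {b : Fin m → ℝ} {rounding : Bool} {Δ : ℝ}

/-- The invariant of the full algorithm. -/
structure LPInvariant (rounding : Bool) (Δ : ℝ) (s : LPState ℝ n) : Prop where
  injective : Function.Injective s.idx
  lower : ∀ j, 1 / Δ ≤ s.u j
  upper : ∀ j, s.u j ≤ Δ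
  multiple : rounding = true → ∀ j, ∃ z : ℤ, s.u j * (3 * n * Δ) = z

/-- The fixed variables of `x` vanish, the others satisfy the bounds. -/
structure LPState.Bounds (s : LPState ℝ n) (x : Fin n → ℝ) : Prop where
  fixed : ∀ i, (∀ j, s.idx j ≠ i) → x i = 0
  le : ∀ j, x (s.idx j) ≤ s.u j

/-- A feasible point without positive entries below `1 / Δ`. -/
structure Discrete (A : Fin m → Fin n → ℝ) (b : Fin m → ℝ) (Δ : ℝ) (x : Fin n → ℝ) : Prop where
  solves : Solves A b x
  nonneg : ∀ j, 0 ≤ x j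
  lower : ∀ j, x j ≠ 0 → 1 / Δ ≤ x j

/-- The logarithm of the product of the scaled bounds. -/
noncomputable def LPState.potential (Δ : ℝ) (s : LPState ℝ n) : ℝ :=
  ∑ j, Real.log (s.u j * Δ)

lemma LPInvariant.log_nonneg {s : LPState ℝ n} (hΔ : 0 < Δ) (hs : LPInvariant rounding Δ s)
    (j : Fin s.size) : 0 ≤ Real.log (s.u j * Δ) :=
  Real.log_nonneg ((div_le_iff₀ hΔ).1 (hs.lower j))

lemma LPInvariant.potential_nonneg {s : LPState ℝ n} (hΔ : 0 < Δ) (hs : LPInvariant rounding Δ s) :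
    0 ≤ s.potential Δ :=
  Finset.sum_nonneg fun j _ => hs.log_nonneg hΔ j

lemma LPInvariant.potential_le {s : LPState ℝ n} (hΔ : 0 < Δ) (hs : LPInvariant rounding Δ s) :
    s.potential Δ ≤ 2 * s.size * Real.log Δ := by
  calc s.potential Δ ≤ ∑ _j : Fin s.size, 2 * Real.log Δ := by
        refine Finset.sum_le_sum fun j _ => ?_
        have h0 : 0 < s.u j := (div_pos one_pos hΔ).trans_le (hs.lower j)
        rw [Real.log_mul h0.ne' hΔ.ne']
        linarith [Real.log_le_log h0 (hs.upper j)]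
    _ = 2 * s.size * Real.log Δ := by
        simp only [Finset.sum_const, Finset.card_univ, Fintype.card_fin, nsmul_eq_mul]
        ring

/-- The progress made by an iteration that goes on. -/
structure Progress (A : Fin m → Fin n → ℝ) (b : Fin m → ℝ) (rounding : Bool) (Δ : ℝ)
    (s s' : LPState ℝ n) : Prop where
  invariant : LPInvariant rounding Δ s'
  bounds : ∀ x, Discrete A b Δ x → s.Bounds x → s'.Bounds x
  pos : 0 < s.size
  size_le : s'.size ≤ s.size
  potential_le : s'.potential Δ ≤ s.potential Δ
  potential_add_le : s'.size = s.size →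
    s'.potential Δ + Real.log (s.size + 1) / 2 ≤ s.potential Δ

/-- log 2 > 2/3. The term 1/3 is the total loss by rounding. -/
lemma log_succ_sub_ge {k : ℕ} (hk : 0 < k) : Real.log (k + 1) / 2 ≤ Real.log (k + 1) - 1 / 3 := by
  have h1 : (1 : ℝ) ≤ k := by exact_mod_cast hk
  have h2 : Real.log 2 ≤ Real.log (k + 1) := Real.log_le_log (by norm_num) (by linarith)
  linarith [Real.log_two_gt_d9]

/-- Replace the bounds by `v`, and keep the variables in the list `keep` only. -/
def LPState.restrict (s : LPState ℝ n) (keep : List (Fin s.size)) (v : Fin s.size → ℝ) :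
    LPState ℝ n :=
  ⟨keep.length, fun j => s.idx (keep.get j), fun j => v (keep.get j)⟩

lemma filter_not_lt_val {k : ℕ} (u : Fin k → ℝ) (x : ℝ) (l : List (Fin k)) :
    (Cost.filter (fun j => do
      let t ← realMachine.lt (u j) x
      pure (!t)) l).val = l.filter fun j => x ≤ u j := by
  rw [Cost.filter_val]
  refine List.filter_congr fun j _ => ?_
  rw [Bool.eq_iff_iff]
  simp

lemma LPState.potential_restrict (s : LPState ℝ n) (p : Fin s.size → Prop) [DecidablePred p]
    (v : Fin s.size → ℝ) :
    (s.restrict ((List.finRange s.size).filter fun j => p j) v).potential Δ =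
      ∑ j, if p j then Real.log (v j * Δ) else 0 := by
  set keep := (List.finRange s.size).filter fun j => p j with hk
  have hnd : keep.Nodup := (List.nodup_finRange _).filter _
  have hmem : ∀ j, j ∈ keep ↔ p j := fun j => by simp [hk]
  refine Fintype.sum_of_injective keep.get (List.nodup_iff_injective_get.1 hnd) _ _
    (fun j hj => if_neg fun h => hj ?_) fun j => ?_
  · exact List.mem_iff_get.1 ((hmem j).2 h)
  · rw [if_pos ((hmem _).1 (List.get_mem _ _))]
    rfl

lemma LPInvariant.progress {s : LPState ℝ n} (hΔ : 1 ≤ Δ) (hs : LPInvariant rounding Δ s)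
    {w : Fin s.size → ℝ} (hw : IsCert (fun i j => A i (s.idx j)) b s.u w) {tot : ℝ}
    (htot : 0 < tot) (ht : tot = ∑ j, s.u j * w j) (hpos : 0 < s.size) {u₁ v : Fin s.size → ℝ}
    (hu₁ : ∀ j, u₁ j = (newBound realMachine tot s.u w j).val)
    (hv : ∀ j, v j = if rounding then (roundUp realMachine n Δ (u₁ j)).val else u₁ j) :
    Progress A b rounding Δ s
      (s.restrict ((List.finRange s.size).filter fun j => 1 / Δ ≤ u₁ j) v) := by
  set keep := (List.finRange s.size).filter fun j => 1 / Δ ≤ u₁ j with hk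
  have hΔ0 : 0 < Δ := zero_lt_one.trans_le hΔ
  have hu : ∀ j, 0 < s.u j := fun j => (div_pos one_pos hΔ0).trans_le (hs.lower j)
  have hsn : s.size ≤ n := by simpa using Fintype.card_le_of_injective _ hs.injective
  have hn : 0 < n := hpos.trans_le hsn
  have hn' : (0 : ℝ) < n := by exact_mod_cast hn
  have hq : ∀ j, 0 < u₁ j ∧ u₁ j ≤ s.u j := fun j => by
    rw [hu₁]
    have := newBound_spec (w := w) hu htot j
    exact ⟨this.1, this.2.1⟩
  have hnd : keep.Nodup := (List.nodup_finRange _).filter _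
  have hmem : ∀ j, j ∈ keep ↔ 1 / Δ ≤ u₁ j := fun j => by simp [hk]
  have hv₁ : ∀ j, u₁ j ≤ v j := fun j => by
    rw [hv]
    split_ifs
    exacts [(roundUp_spec hn hΔ0).1, le_rfl]
  have hv₂ : ∀ j, v j ≤ s.u j := fun j => by
    rw [hv]
    split_ifs with hr
    exacts [(roundUp_spec hn hΔ0).2.2.2 _ (hq j).2 (hs.multiple hr j), (hq j).2]
  have hv₃ : ∀ j, 1 / Δ ≤ u₁ j → v j ≤ u₁ j * (1 + 1 / (3 * n)) := fun j hj => by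
    rw [hv]
    split_ifs with hr
    · exact (roundUp_spec hn hΔ0).2.1 hj
    · exact le_mul_of_one_le_right (hq j).1.le (le_add_of_nonneg_right (by positivity))
  -- Dropping a variable cannot raise the potential, because the lower bound 1/Δ makes every term
  -- nonnegative.
  have hpot : ∑ j, (if 1 / Δ ≤ u₁ j then Real.log (v j * Δ) else 0) ≤ s.potential Δ := by
    refine Finset.sum_le_sum fun j _ => ?_
    split_ifs with hj
    · exact Real.log_le_log (mul_pos ((hq j).1.trans_le (hv₁ j)) hΔ0)
        (mul_le_mul_of_nonneg_right (hv₂ j) hΔ0.le)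
    · exact hs.log_nonneg hΔ0 j
  have hlen : keep.length ≤ s.size := (List.length_filter_le _ _).trans (by simp)
  -- All terms of w·x are nonnegative, so each w_j x_j is below w·ℓ = `tot / (2 * s.size)`.
  have hcert : ∀ x, Discrete A b Δ x → s.Bounds x → ∀ j, x (s.idx j) ≤ u₁ j := by
    intro x hx hb j
    have h1 := hw.lt (fun j => x (s.idx j))
      (fun i => by rw [← sum_mul_eq_sum_idx hs.injective _ hb.fixed, hx.solves i])
      (fun j => hx.nonneg _) hb.le
    have h2 : ∑ j, w j * (s.u j / (2 * s.size)) = tot / (2 * s.size) := by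
      rw [ht, Finset.sum_div]
      exact Finset.sum_congr rfl fun _ _ => by ring
    have h3 : w j * x (s.idx j) ≤ ∑ j, w j * x (s.idx j) :=
      Finset.single_le_sum (f := fun j => w j * x (s.idx j))
        (fun j _ => mul_nonneg (hw.nonneg j) (hx.nonneg _)) (Finset.mem_univ j)
    have hsz : (0 : ℝ) < s.size := by exact_mod_cast hpos
    rw [hu₁]
    obtain ⟨-, -, -, h | ⟨hwj, h⟩⟩ := newBound_spec (w := w) hu htot j
    · rw [h]
      exact hb.le j
    · rw [h, le_div_iff₀ (by positivity)]
      rw [h2, lt_div_iff₀ (by positivity)] at h1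
      nlinarith
  refine ⟨⟨?_, ?_, ?_, ?_⟩, fun x hx hb => ⟨fun i hi => ?_, fun j => ?_⟩, hpos, hlen, ?_,
    fun hsize => ?_⟩
  · exact hs.injective.comp (List.nodup_iff_injective_get.1 hnd)
  · exact fun j => ((hmem _).1 (List.get_mem _ _)).trans (hv₁ _)
  · exact fun j => (hv₂ _).trans (hs.upper _)
  · intro hr j
    simp only [LPState.restrict, hv, hr, if_true]
    exact (roundUp_spec hn hΔ0).2.2.1
  · by_cases hi' : ∀ j, s.idx j ≠ i
    · exact hb.fixed i hi'
    · push Not at hi'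
      obtain ⟨j, rfl⟩ := hi'
      by_contra h0
      have hj : j ∈ keep := (hmem j).2 ((hx.lower _ h0).trans (hcert x hx hb j))
      obtain ⟨l, hl⟩ := List.mem_iff_get.1 hj
      exact hi l (congrArg s.idx hl)
  · exact (hcert x hx hb _).trans (hv₁ _)
  · rw [hk, s.potential_restrict]
    exact hpot
  · have hall : ∀ j, 1 / Δ ≤ u₁ j := fun j => by
      have h1 : keep.length = (List.finRange s.size).length :=
        hsize.trans List.length_finRange.symm
      have := List.length_filter_eq_length_iff.1 h1 j (List.mem_finRange j)
      simpa using this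
    rw [hk, s.potential_restrict]
    -- Rounding multiplies a bound by at most 1 + 1/(3n), hence adds at most 1/(3n) to its
    -- logarithm, and at most 1/3 over all free variables.
    have h1 : ∀ j, Real.log (v j * Δ) ≤
        Real.log (s.u j * Δ) - Real.log (s.u j / u₁ j) + 1 / (3 * n) := fun j => by
      have hj := (hq j).1
      have hvj : 0 < v j := hj.trans_le (hv₁ j)
      have h2 : Real.log (v j) ≤ Real.log (u₁ j) + 1 / (3 * n) := by
        refine (Real.log_le_log hvj (hv₃ j (hall j))).trans ?_
        rw [Real.log_mul hj.ne' (by positivity)]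
        have := Real.log_le_sub_one_of_pos (x := 1 + 1 / (3 * (n : ℝ))) (by positivity)
        linarith
      rw [Real.log_mul hvj.ne' hΔ0.ne', Real.log_mul (hu j).ne' hΔ0.ne',
        Real.log_div (hu j).ne' hj.ne']
      linarith
    have h2 := log_succ_le_sum_log_div hu htot ht
    simp only [← hu₁] at h2
    have h3 := Finset.sum_le_sum fun j (_ : j ∈ Finset.univ) => h1 j
    simp only [Finset.sum_add_distrib, Finset.sum_sub_distrib, Finset.sum_const, Finset.card_univ,
      Fintype.card_fin, nsmul_eq_mul] at h3
    have h4 : (s.size : ℝ) * (1 / (3 * n)) ≤ 1 / 3 := by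
      have : (s.size : ℝ) ≤ n := by exact_mod_cast hsn
      rw [mul_one_div, div_le_div_iff₀ (by positivity) (by norm_num)]
      linarith
    have h5 := log_succ_sub_ge hpos
    simp only [hall, if_true]
    change _ ≤ ∑ j, Real.log (s.u j * Δ)
    linarith

theorem lpStep_spec {s : LPState ℝ n} (hΔ : 1 ≤ Δ) (hs : LPInvariant rounding Δ s) :
    (∀ x, (lpStep realMachine rounding A b Δ s).val = Sum.inr (some x) →
      Solves A b x ∧ ∀ j, 0 ≤ x j) ∧
    ((lpStep realMachine rounding A b Δ s).val = Sum.inr none →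
      ∀ x, Discrete A b Δ x → ¬ s.Bounds x) ∧
    ∀ s', (lpStep realMachine rounding A b Δ s).val = Sum.inl s' →
      Progress A b rounding Δ s s' := by
  have hΔ0 : 0 < Δ := zero_lt_one.trans_le hΔ
  have hu : ∀ j, 0 < s.u j := fun j => (div_pos one_pos hΔ0).trans_le (hs.lower j)
  have he : ∀ j, 0 < s.u j * s.u j / 4 := fun j => by have := hu j; positivity
  have hrestr : ∀ x, Discrete A b Δ x → s.Bounds x →
      Solves (fun i j => A i (s.idx j)) b fun j => x (s.idx j) := fun x hx hb i => by
    rw [← sum_mul_eq_sum_idx hs.injective _ hb.fixed, hx.solves i]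
  simp only [lpStep, Cost.bind_val, invD_val]
  rcases hE : (eliminate realMachine (fun j => s.u j * s.u j / 4) (fun i j => A i (s.idx j)) b
    (List.finRange m) []).val with B | v
  swap
  · simp only [Cost.pure_val]
    exact ⟨fun _ h => by simp at h, fun _ x hx hb =>
      unsolvable_of_eliminate he hE ⟨_, hrestr x hx hb⟩, fun _ h => by simp at h⟩
  have hB := isEliminated_of_eliminate he hE
  simp only
  by_cases hlen : B.length = s.size
  · rw [if_pos hlen]
    obtain ⟨h₁, -⟩ := hB.closest he
    simp only [Cost.bind_val]
    set r := (scaledMul realMachine (fun j => s.u j * s.u j / 4) (fun i j => A i (s.idx j))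
      (closestMult realMachine B).val).val
    rcases hf : (findNeg realMachine r).val with _ | i
    · refine ⟨?_, fun h => by simp at h, fun _ h => by simp at h⟩
      rintro x h
      obtain rfl := Option.some.inj (Sum.inr.inj h)
      exact solves_extend hs.injective h₁ (findNeg_none hf)
    · refine ⟨fun _ h => by simp at h, fun _ x hx hb => ?_, fun _ h => by simp at h⟩
      have h₂ := hB.eq_zero_of_ker hlen ((hrestr x hx hb).sub h₁)
      have h₃ := findNeg_some hf
      have h₄ := congrFun h₂ i
      simp only [Pi.sub_apply, Pi.zero_apply] at h₄
      linarith [hx.nonneg (s.idx i)]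
  rw [if_neg hlen]
  have hpos : 0 < s.size := (Nat.zero_le _).trans_lt (lt_of_le_of_ne hB.length_le hlen)
  have hbub := bubble_spec (A := fun i j => A i (s.idx j)) (b := b) hu
  simp only [Cost.bind_val, Cost.call_val]
  rcases hout : (bubble realMachine (fun i j => A i (s.idx j)) b s.u).val with x | ⟨v, w⟩
  · rw [hout] at hbub
    refine ⟨?_, fun h => by simp at h, fun _ h => by simp at h⟩
    rintro y h
    obtain rfl := Option.some.inj (Sum.inr.inj h)
    exact solves_extend hs.injective hbub.1 hbub.2
  rw [hout] at hbub
  have hcert : IsCert (fun i j => A i (s.idx j)) b s.u w := hbub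
  simp only [Cost.bind_val, Cost.ite_val, realMachine_lt, realMachine_const, Nat.cast_zero, dot_val]
  by_cases htot : 0 < ∑ j, s.u j * w j
  · rw [if_pos htot]
    have hp := fun v hv => hs.progress (v := v) hΔ hcert htot rfl hpos (fun j => rfl) hv
    have hone : 1 / Δ = (realMachine.div ((1 : ℕ) : ℝ) Δ).val := by simp
    rw [← filter_not_lt_val, hone] at hp
    cases rounding
    all_goals
      refine ⟨fun _ h => by simp at h, fun h => by simp at h, ?_⟩
      rintro s' h
      obtain rfl := Sum.inl.inj h
    · exact hp _ fun j => rfl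
    · exact hp _ fun j => rfl
  · rw [if_neg htot]
    refine ⟨fun _ h => by simp at h, fun _ x hx hb => ?_, fun _ h => by simp at h⟩
    have h1 := hcert.lt _ (hrestr x hx hb) (fun j => hx.nonneg _) hb.le
    have h2 : ∑ j, w j * (s.u j / (2 * s.size)) = (∑ j, s.u j * w j) / (2 * s.size) := by
      rw [Finset.sum_div]
      exact Finset.sum_congr rfl fun _ _ => by ring
    have h3 : (∑ j, s.u j * w j) / (2 * s.size) ≤ 0 :=
      div_nonpos_of_nonpos_of_nonneg (not_lt.1 htot) (by positivity)
    have h4 : 0 ≤ ∑ j, w j * x (s.idx j) :=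
      Finset.sum_nonneg fun j _ => mul_nonneg (hcert.nonneg j) (hx.nonneg _)
    linarith

end Step

/-! ### The number of iterations -/

section Iterations

variable {m n : ℕ} {A : Fin m → Fin n → ℝ} {b : Fin m → ℝ} {rounding : Bool} {Δ : ℝ}

/-- A bound for the number of further iterations.  A call with more than `√n` free variables
decreases the potential by at least `log n / 4`, every other call by a constant, unless a
variable is fixed. -/
noncomputable def budget (Δ : ℝ) (s : LPState ℝ n) : ℝ :=
  s.size + if √n < s.size then 4 * s.potential Δ / Real.log n + 6 * √n * Real.log Δ
    else 3 * s.potential Δ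

lemma LPInvariant.budget_nonneg {s : LPState ℝ n} (hΔ : 1 ≤ Δ) (hs : LPInvariant rounding Δ s) :
    0 ≤ budget Δ s := by
  have h1 := hs.potential_nonneg (zero_lt_one.trans_le hΔ)
  have h2 := Real.log_natCast_nonneg n
  have h3 := Real.log_nonneg hΔ
  rw [budget]
  split_ifs <;> positivity

lemma Progress.budget_add_one_le {s s' : LPState ℝ n} (hn : 2 ≤ n) (hΔ : 1 ≤ Δ)
    (h : Progress A b rounding Δ s s') : budget Δ s' + 1 ≤ budget Δ s := by
  have hΔ0 : 0 < Δ := zero_lt_one.trans_le hΔ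
  have hn' : (2 : ℝ) ≤ n := by exact_mod_cast hn
  have hlog : 0 < Real.log n := Real.log_pos (by linarith)
  have h1 := h.potential_le
  have h2 := h.invariant.potential_nonneg hΔ0
  have hT := Real.log_nonneg hΔ
  rw [budget, budget]
  rcases h.size_le.lt_or_eq with hlt | heq
  · have hsz : (s'.size : ℝ) + 1 ≤ s.size := by exact_mod_cast hlt
    -- When the size falls to √n or below, the new term 3 · potential is at most 6√n log Δ, which
    -- the first branch holds in reserve for this moment.
    have hle : s'.size ≤ s.size → (if √n < s'.size then
        4 * s'.potential Δ / Real.log n + 6 * √n * Real.log Δ else 3 * s'.potential Δ) ≤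
        if √n < s.size then 4 * s.potential Δ / Real.log n + 6 * √n * Real.log Δ
        else 3 * s.potential Δ := fun _ => by
      split_ifs with h3 h4 h4
      · gcongr
      · linarith
      · have h5 := h.invariant.potential_le hΔ0
        have h6 : 3 * s'.potential Δ ≤ 6 * √n * Real.log Δ := by
          nlinarith [mul_le_mul_of_nonneg_right (not_lt.1 h3) hT]
        have h7 : 0 ≤ 4 * s.potential Δ / Real.log n := by
          have := h2.trans h1
          positivity
        linarith
      · linarith
    linarith [hle h.size_le]
  · have h3 := h.potential_add_le heq
    rw [heq]
    have hs1 : (1 : ℝ) ≤ s.size := by exact_mod_cast h.pos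
    split_ifs with h4
    · have h5 : Real.log n / 2 ≤ Real.log (s.size + 1) := by
        rw [← Real.log_sqrt (by linarith)]
        exact Real.log_le_log (Real.sqrt_pos.2 (by linarith)) (by linarith)
      have h6 : 4 * s'.potential Δ / Real.log n + 1 ≤ 4 * s.potential Δ / Real.log n := by
        rw [div_add_one hlog.ne']
        gcongr
        linarith
      linarith
    · have h5 : Real.log 2 ≤ Real.log (s.size + 1) :=
        Real.log_le_log (by norm_num) (by linarith)
      linarith [Real.log_two_gt_d9]

/-- A correct answer of the full algorithm, started in the state `s`. -/
def CorrectAnswer (A : Fin m → Fin n → ℝ) (b : Fin m → ℝ) (Δ : ℝ) (s : LPState ℝ n) :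
    Option (Fin n → ℝ) → Prop
  | some x => Solves A b x ∧ ∀ j, 0 ≤ x j
  | none => ∀ x, Discrete A b Δ x → ¬ s.Bounds x

lemma Cost.iterate_succ_inr {σ α : Type} {step : σ → Cost (σ ⊕ α)} {s : σ} {a : α}
    (h : (step s).val = Sum.inr a) (k : ℕ) :
    Cost.iterate step (k + 1) s = ⟨Sum.inr a, (step s).ops, (step s).calls⟩ := by
  rw [Cost.iterate]
  change Cost.mk _ _ _ = _
  rw [h]
  rfl

lemma Cost.iterate_succ_inl {σ α : Type} {step : σ → Cost (σ ⊕ α)} {s s' : σ}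
    (h : (step s).val = Sum.inl s') (k : ℕ) :
    Cost.iterate step (k + 1) s =
      ⟨(Cost.iterate step k s').val, (step s).ops + (Cost.iterate step k s').ops,
        (step s).calls + (Cost.iterate step k s').calls⟩ := by
  rw [Cost.iterate]
  change Cost.mk _ _ _ = _
  rw [h]

lemma correctAnswer_of_lpStep {s : LPState ℝ n} (hΔ : 1 ≤ Δ) (hs : LPInvariant rounding Δ s)
    {out : Option (Fin n → ℝ)}
    (h : (lpStep realMachine rounding A b Δ s).val = Sum.inr out) : CorrectAnswer A b Δ s out := by
  obtain ⟨h₁, h₂, -⟩ := lpStep_spec (A := A) (b := b) hΔ hs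
  cases out with
  | none => exact h₂ h
  | some x => exact h₁ x h

lemma CorrectAnswer.of_progress {s s' : LPState ℝ n} (h : Progress A b rounding Δ s s') :
    ∀ {out : Option (Fin n → ℝ)}, CorrectAnswer A b Δ s' out → CorrectAnswer A b Δ s out
  | some _, ho => ho
  | none, ho => fun x hx hb => ho x hx (h.bounds x hx hb)

/-- Every iteration that goes on uses up one unit of a nonnegative budget. The added 1 pays for the
iteration that answers. -/
lemma iterate_lpStep_spec (hn : 2 ≤ n) (hmn : m ≤ n) (hΔ : 1 ≤ Δ) (k : ℕ) (s : LPState ℝ n)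
    (hs : LPInvariant rounding Δ s) (hk : budget Δ s ≤ k) :
    let run := Cost.iterate (lpStep realMachine rounding A b Δ) (k + 1) s
    (∃ out, run.val = Sum.inr out ∧ CorrectAnswer A b Δ s out) ∧
      (run.calls : ℝ) ≤ budget Δ s + 1 ∧
      (run.ops : ℝ) ≤ (budget Δ s + 1) * (400 * (n + 1) ^ 4) := by
  induction k generalizing s with
  | zero =>
    have hb := hs.budget_nonneg hΔ
    obtain ⟨hops, hcalls⟩ := realMachine_unitCost.lpStep_within rounding A b Δ s hmn le_rfl
      (by simpa using Fintype.card_le_of_injective _ hs.injective)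
    have hops' : ((lpStep realMachine rounding A b Δ s).ops : ℝ) ≤ 400 * (n + 1) ^ 4 := by
      exact_mod_cast hops
    have hcalls' : ((lpStep realMachine rounding A b Δ s).calls : ℝ) ≤ 1 := by exact_mod_cast hcalls
    rcases hv : (lpStep realMachine rounding A b Δ s).val with s' | out
    · have hp := (lpStep_spec hΔ hs).2.2 s' hv
      have h1 := hp.budget_add_one_le hn hΔ
      have h2 := hp.invariant.budget_nonneg hΔ
      rw [Nat.cast_zero] at hk
      linarith
    · rw [Cost.iterate_succ_inr hv]
      exact ⟨⟨out, rfl, correctAnswer_of_lpStep hΔ hs hv⟩, by linarith,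
        hops'.trans (le_mul_of_one_le_left (by positivity) (by linarith))⟩
  | succ k ih =>
    have hb := hs.budget_nonneg hΔ
    obtain ⟨hops, hcalls⟩ := realMachine_unitCost.lpStep_within rounding A b Δ s hmn le_rfl
      (by simpa using Fintype.card_le_of_injective _ hs.injective)
    have hops' : ((lpStep realMachine rounding A b Δ s).ops : ℝ) ≤ 400 * (n + 1) ^ 4 := by
      exact_mod_cast hops
    have hcalls' : ((lpStep realMachine rounding A b Δ s).calls : ℝ) ≤ 1 := by exact_mod_cast hcalls
    rcases hv : (lpStep realMachine rounding A b Δ s).val with s' | out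
    · have hp := (lpStep_spec hΔ hs).2.2 s' hv
      have h1 := hp.budget_add_one_le hn hΔ
      rw [Nat.cast_succ] at hk
      obtain ⟨⟨out, ho, hcor⟩, hc, hop⟩ := ih s' hp.invariant (by linarith)
      rw [Cost.iterate_succ_inl hv]
      refine ⟨⟨out, ho, hcor.of_progress hp⟩, ?_, ?_⟩
      · push_cast
        linarith
      · push_cast
        have h3 : (budget Δ s' + 1) * (400 * ((n : ℝ) + 1) ^ 4) ≤
            budget Δ s * (400 * ((n : ℝ) + 1) ^ 4) :=
          mul_le_mul_of_nonneg_right h1 (by positivity)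
        linarith
    · rw [Cost.iterate_succ_inr hv]
      exact ⟨⟨out, rfl, correctAnswer_of_lpStep hΔ hs hv⟩, by linarith,
        hops'.trans (le_mul_of_one_le_left (by positivity) (by linarith))⟩

lemma lpInvariant_init (hΔ : 1 ≤ Δ) (h : ∃ z : ℤ, Δ ^ 2 = z) :
    LPInvariant rounding Δ (⟨n, id, fun _ => Δ⟩ : LPState ℝ n) where
  injective := Function.injective_id
  lower _ := ((div_le_one (zero_lt_one.trans_le hΔ)).2 hΔ).trans hΔ
  upper _ := le_rfl
  multiple _ _ := by
    obtain ⟨z, hz⟩ := h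
    refine ⟨3 * n * z, ?_⟩
    push_cast
    rw [← hz]
    ring

lemma le_encodingSize (hm : 1 ≤ m) (A : Matrix (Fin m) (Fin n) ℤ) (b : Fin m → ℤ) :
    n ≤ encodingSize A b := by
  calc n ≤ m * n := Nat.le_mul_of_pos_left n hm
    _ = ∑ _i : Fin m, ∑ _j : Fin n, 1 := by simp
    _ ≤ ∑ i, ∑ j, intSize (A i j) :=
        Finset.sum_le_sum fun _ _ => Finset.sum_le_sum fun _ _ => by simp [intSize]
    _ ≤ encodingSize A b := Nat.le_add_right _ _

/-- Since log n = 2 log √n ≤ 2√n. It absorbs the phase with at most √n free variables into the main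
term. -/
lemma sqrt_le_two_mul_div_log (hn : 2 ≤ n) : √n ≤ 2 * (n / Real.log n) := by
  have hn' : (2 : ℝ) ≤ n := by exact_mod_cast hn
  have hlog : 0 < Real.log n := Real.log_pos (by linarith)
  have h1 : Real.log n ≤ 2 * √n := by
    have := Real.log_le_sub_one_of_pos (Real.sqrt_pos.2 (show (0 : ℝ) < n by linarith))
    rw [Real.log_sqrt (by linarith)] at this
    linarith
  rw [mul_div_assoc', le_div_iff₀ hlog]
  nlinarith [Real.sqrt_nonneg n, Real.mul_self_sqrt (show (0 : ℝ) ≤ n by linarith)]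

lemma budget_init_add_one_le (hn : 2 ≤ n) (hΔ : 1 ≤ Δ) (h : LPInvariant rounding Δ
    (⟨n, id, fun _ => Δ⟩ : LPState ℝ n)) {L : ℝ} (hL : n ≤ L) (hΔL : Real.log Δ ≤ L) :
    budget Δ (⟨n, id, fun _ => Δ⟩ : LPState ℝ n) + 1 ≤ 22 * (n / Real.log n) * L := by
  have hn' : (2 : ℝ) ≤ n := by exact_mod_cast hn
  have hlog : 0 < Real.log n := Real.log_pos (by linarith)
  have hlogn : Real.log n ≤ n := by linarith [Real.log_le_sub_one_of_pos (show (0 : ℝ) < n by linarith)]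
  have hpot := h.potential_le (zero_lt_one.trans_le hΔ)
  have hT := Real.log_nonneg hΔ
  have hlt : √n < n := (Real.sqrt_lt' (by linarith)).2 (by nlinarith)
  have h1 : (n : ℝ) ≤ n / Real.log n * L := by
    rw [div_mul_eq_mul_div, le_div_iff₀ hlog]
    exact mul_le_mul_of_nonneg_left (hlogn.trans hL) (by linarith)
  have h2 : 4 * LPState.potential Δ (⟨n, id, fun _ => Δ⟩ : LPState ℝ n) / Real.log n ≤
      8 * (n / Real.log n * L) := by
    rw [div_mul_eq_mul_div, mul_div_assoc']
    refine div_le_div_of_nonneg_right ?_ hlog.le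
    simp only at hpot
    nlinarith
  have h3 : 6 * √n * Real.log Δ ≤ 12 * (n / Real.log n * L) := by
    have := sqrt_le_two_mul_div_log hn
    calc 6 * √n * Real.log Δ ≤ 6 * (2 * (n / Real.log n)) * L := by gcongr
      _ = _ := by ring
  -- 22 = 1 + 8 + 12 + 1: fixing variables, the large phase, the small phase and the final
  -- iteration, each in units of (n / log n) L.
  rw [budget, if_pos hlt]
  simp only
  linarith

end Iterations

end BubbleLP

/-! ### The main theorem -/

theorem mainTheorem2 :
    ∃ C : ℝ, 0 < C ∧
      ∀ (rounding : Bool) (m n : ℕ) (A : Matrix (Fin m) (Fin n) ℤ) (b : Fin m → ℤ),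
        1 ≤ m → 2 ≤ n → (A.map (Int.cast : ℤ → ℝ)).rank = m →
        ∃ (k : ℕ) (out : Option (Fin n → ℝ)),
          let run := BubbleLP.lpAlgorithm BubbleLP.realMachine rounding
            (fun i j => (A i j : ℝ)) (fun i => (b i : ℝ)) k
          run.val = Sum.inr out ∧
          (∀ x, out = some x →
            (A.map (Int.cast : ℤ → ℝ)).mulVec x = (fun i => (b i : ℝ)) ∧ ∀ j, 0 ≤ x j) ∧
          (out = none →
            ¬ ∃ x : Fin n → ℝ,
              (A.map (Int.cast : ℤ → ℝ)).mulVec x = (fun i => (b i : ℝ)) ∧ ∀ j, 0 ≤ x j) ∧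
          (run.calls : ℝ) ≤ C * ((n : ℝ) / Real.log n) * (BubbleLP.encodingSize A b : ℝ) ∧
          (run.ops : ℝ) ≤ C * ((n : ℝ) ^ 5 / Real.log n) * (BubbleLP.encodingSize A b : ℝ) := by
  -- The constant covers 22 · (400 + 20) · 16 = 147840: the budget, the cost of an iteration and of
  -- computing Δ, and (n + 1)⁴ ≤ 16n⁴.
  refine ⟨150000, by norm_num, fun rounding m n A b hm hn hrank => ?_⟩
  have hmn : m ≤ n := hrank ▸ Matrix.rank_le_width _
  have hΔ := BubbleLP.one_le_Delta hrank b
  set Δ := BubbleLP.Delta A b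
  have hinit := BubbleLP.lpInvariant_init (n := n) (rounding := rounding) hΔ
    (BubbleLP.exists_intCast_eq_Delta_sq A b)
  set s₀ : BubbleLP.LPState ℝ n := ⟨n, id, fun _ => Δ⟩
  set L : ℝ := (BubbleLP.encodingSize A b : ℝ)
  have hL : (n : ℝ) ≤ L := Nat.cast_le.2 (BubbleLP.le_encodingSize hm A b)
  have hbud := BubbleLP.budget_init_add_one_le hn hΔ hinit hL (BubbleLP.log_Delta_le A b hΔ)
  have hn' : (2 : ℝ) ≤ n := by exact_mod_cast hn
  have hlog : 0 < Real.log n := Real.log_pos (by linarith)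
  have hL0 : 0 ≤ L := by linarith
  obtain ⟨⟨out, hout, hcor⟩, hcalls, hops⟩ :=
    BubbleLP.iterate_lpStep_spec (A := fun i j => (A i j : ℝ)) (b := fun i => (b i : ℝ)) hn hmn hΔ
      ⌈BubbleLP.budget Δ s₀⌉₊ s₀ hinit (Nat.le_ceil _)
  obtain ⟨hdops, hdcalls⟩ := BubbleLP.realMachine_unitCost.delta_within
    (fun i j => (A i j : ℝ)) (fun i => (b i : ℝ)) hmn le_rfl
  set run₀ := BubbleLP.Cost.iterate (BubbleLP.lpStep BubbleLP.realMachine rounding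
    (fun i j => (A i j : ℝ)) (fun i => (b i : ℝ)) Δ) (⌈BubbleLP.budget Δ s₀⌉₊ + 1) s₀
  set d := BubbleLP.delta BubbleLP.realMachine (fun i j => (A i j : ℝ)) (fun i => (b i : ℝ))
  have hrun : BubbleLP.lpAlgorithm BubbleLP.realMachine rounding
      (fun i j => (A i j : ℝ)) (fun i => (b i : ℝ)) (⌈BubbleLP.budget Δ s₀⌉₊ + 1) =
      ⟨run₀.val, d.ops + run₀.ops, d.calls + run₀.calls⟩ := rfl
  have hsolves : ∀ x : Fin n → ℝ, (A.map (Int.cast : ℤ → ℝ)).mulVec x = (fun i => (b i : ℝ)) ↔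
      BubbleLP.Solves (fun i j => (A i j : ℝ)) (fun i => (b i : ℝ)) x := fun x => funext_iff
  have hq0 : 0 ≤ n / Real.log n * L := by positivity
  refine ⟨⌈BubbleLP.budget Δ s₀⌉₊ + 1, out, ?_⟩
  rw [hrun]
  refine ⟨hout, ?_, ?_, ?_, ?_⟩
  · rintro x rfl
    exact ⟨(hsolves x).2 hcor.1, hcor.2⟩
  · rintro rfl hx
    -- Initially no variable is fixed and all bounds are Δ, so the basic solution meets them.
    obtain ⟨x, ⟨hx, hx0⟩, hxΔ⟩ := BubbleLP.exists_bounded_solution hrank b hx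
    exact hcor x ⟨(hsolves x).1 hx, hx0, fun j => (hxΔ j).2⟩
      ⟨fun i hi => absurd rfl (hi i), fun j => (hxΔ j).1⟩
  · rw [hdcalls, zero_add]
    refine hcalls.trans (hbud.trans ?_)
    rw [mul_assoc, mul_assoc]
    linarith
  · have hdops' : (d.ops : ℝ) ≤ 20 * (n + 1) ^ 4 := by exact_mod_cast hdops
    have hpow : ((n : ℝ) + 1) ^ 4 ≤ 16 * (n : ℝ) ^ 4 := by
      calc ((n : ℝ) + 1) ^ 4 ≤ (2 * (n : ℝ)) ^ 4 := by gcongr; linarith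
        _ = 16 * (n : ℝ) ^ 4 := by ring
    have hone : 1 ≤ 22 * ((n : ℝ) / Real.log n) * L := by
      linarith [hinit.budget_nonneg hΔ]
    push_cast
    calc (d.ops : ℝ) + run₀.ops
        ≤ (22 * ((n : ℝ) / Real.log n) * L) * (20 * ((n : ℝ) + 1) ^ 4) +
          (22 * ((n : ℝ) / Real.log n) * L) * (400 * ((n : ℝ) + 1) ^ 4) :=
          add_le_add (hdops'.trans (le_mul_of_one_le_left (by positivity) hone))
            (hops.trans (mul_le_mul_of_nonneg_right hbud (by positivity)))
      _ = 9240 * ((n : ℝ) / Real.log n * L) * ((n : ℝ) + 1) ^ 4 := by ring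
      _ ≤ 9240 * ((n : ℝ) / Real.log n * L) * (16 * (n : ℝ) ^ 4) :=
          mul_le_mul_of_nonneg_left hpow (by positivity)
      _ ≤ 150000 * ((n : ℝ) / Real.log n * L) * (n : ℝ) ^ 4 := by
          have : 0 ≤ (n : ℝ) / Real.log n * L * (n : ℝ) ^ 4 := by positivity
          linarith
      _ = 150000 * ((n : ℝ) ^ 5 / Real.log n) * L := by ring
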